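/- Let $\zeta$ denote the Riemann zeta function. Let $s=\sigma+it$ with $\sigma,t$ real, and put $\tau=\frac{t}{2\pi}$. If $1\le\sigma\le 3/2$ and $\tau>20$, then \[ \Bigl|\zeta(s)-\sum_{1\le n\le\tau^{1/2}}\frac{1}{n^{s}}\Bigr|\le 39.209\,\tau^{-1/12}+24.447\,\tau^{-1/6}+30.400\,\tau^{-1/2}\log\tau+15.804\,\tau^{-1/2}+8\,\tau^{-1}. \] -/

import Mathlib

/-! Put τ = w^12. The difference is at most 39.2/w, so the first term of the bound alone suffices;
the others are nonnegative. For σ > 1, comparison with an integral bounds the Dirichlet series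
beyond N by 2/t + (σ+t)/(N-1) (`norm_zeta_sub_sum_le`), which is O(w^-2) once N ≥ w^14. The terms
from w^6 to N remain; cutting them into dyadic blocks and summing by parts leaves exponential sums
with phase -τ log n.

From about w^8 on, van der Corput's second-difference test, built on the Kusmin–Landau inequality,
is strong enough (`norm_sum_log_le_second`). From w^6 to about w^8, Weyl–van der Corput differencing
comes first and the same test is applied to the correlations (`norm_sum_log_le_third`). After
division by the block length N this gives 3.4w²/√N + 8.3/w²: the first part decays geometrically
from 3.4/w, the second is multiplied by the number of blocks, O(log w).

For w ≤ 7/2, bounding the terms by 1/n already gives less than 39.2/w. No bound degenerates as σ →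
1, so σ = 1 follows by continuity. -/

/-! ### The additive character and the Kusmin–Landau inequality -/

/-- The additive character `x ↦ exp(2πix)`. -/
noncomputable def unitPhase (x : ℝ) : ℂ := Complex.exp ((2 * Real.pi * x : ℝ) * Complex.I)

lemma norm_unitPhase (x : ℝ) : ‖unitPhase x‖ = 1 := Complex.norm_exp_ofReal_mul_I _

lemma unitPhase_add (x y : ℝ) : unitPhase (x + y) = unitPhase x * unitPhase y := by
  unfold unitPhase
  rw [← Complex.exp_add]
  congr 1
  push_cast
  ring

lemma unitPhase_intCast (k : ℤ) : unitPhase k = 1 := by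
  unfold unitPhase
  rw [Complex.exp_eq_one_iff]
  exact ⟨k, by push_cast; ring⟩

lemma conj_unitPhase (x : ℝ) : (starRingEnd ℂ) (unitPhase x) = unitPhase (-x) := by
  unfold unitPhase
  rw [← Complex.exp_conj]
  rw [map_mul, Complex.conj_ofReal, Complex.conj_I]
  congr 1
  push_cast
  ring

/-- The inverse of `unitPhase g - 1`. -/
noncomputable def cotKernel (g : ℝ) : ℂ :=
  -(1 / 2) - ((Real.cos (Real.pi * g) / (2 * Real.sin (Real.pi * g)) : ℝ) : ℂ) * Complex.I

lemma cotKernel_mul {g : ℝ} (hg : Real.sin (Real.pi * g) ≠ 0) :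
    cotKernel g * (unitPhase g - 1) = 1 := by
  have h : unitPhase g = ((Real.cos (2 * (Real.pi * g)) : ℝ) : ℂ)
      + ((Real.sin (2 * (Real.pi * g)) : ℝ) : ℂ) * Complex.I := by
    unfold unitPhase
    rw [Complex.exp_mul_I, ← Complex.ofReal_cos, ← Complex.ofReal_sin, mul_assoc]
  have h2 := Real.sin_sq_add_cos_sq (Real.pi * g)
  rw [h, Real.cos_two_mul, Real.sin_two_mul, cotKernel]
  generalize Real.sin (Real.pi * g) = a at *
  generalize Real.cos (Real.pi * g) = b at *
  have h3 : (a : ℂ) ^ 2 + (b : ℂ) ^ 2 = 1 := by exact_mod_cast h2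
  have ha : (a : ℂ) ≠ 0 := by exact_mod_cast hg
  push_cast
  field_simp
  linear_combination (-2 * b * Complex.I) * h3
    - 2 * (a : ℂ) * b ^ 2 * Complex.I_sq

lemma two_mul_le_sin_pi_mul {δ g : ℝ} (h1 : δ ≤ g) (h2 : g ≤ 1 - δ) (h0 : 0 < δ) :
    2 * δ ≤ Real.sin (Real.pi * g) := by
  have hpi := Real.pi_pos
  rcases le_total g (1 / 2) with h | h
  · have := Real.mul_le_sin (x := Real.pi * g)
      (mul_nonneg hpi.le (by linarith)) (by nlinarith)
    have h3 : 2 / Real.pi * (Real.pi * g) = 2 * g := by field_simp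
    linarith
  · have := Real.mul_le_sin (x := Real.pi * (1 - g)) (by apply mul_nonneg <;> linarith)
      (by nlinarith)
    have h3 : 2 / Real.pi * (Real.pi * (1 - g)) = 2 * (1 - g) := by field_simp
    have h4 : Real.sin (Real.pi * (1 - g)) = Real.sin (Real.pi * g) := by
      rw [← Real.sin_pi_sub]; congr 1; ring
    linarith

lemma norm_cotKernel_le {δ g : ℝ} (h1 : δ ≤ g) (h2 : g ≤ 1 - δ) (h0 : 0 < δ) :
    ‖cotKernel g‖ ≤ 1 / (4 * δ) := by
  have hs := two_mul_le_sin_pi_mul h1 h2 h0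
  have hm := cotKernel_mul (g := g) (by linarith)
  have hn : ‖unitPhase g - 1‖ = 2 * Real.sin (Real.pi * g) := by
    unfold unitPhase
    have := Complex.norm_exp_I_mul_ofReal_sub_one (2 * Real.pi * g)
    rw [mul_comm Complex.I] at this
    rw [this, Real.norm_eq_abs, abs_of_pos]
    · congr 2; ring
    · have : 2 * Real.pi * g / 2 = Real.pi * g := by ring
      rw [this]; linarith
  have h3 : ‖cotKernel g‖ * (2 * Real.sin (Real.pi * g)) = 1 := by
    rw [← hn, ← norm_mul, hm, norm_one]
  rw [le_div_iff₀ (by positivity)]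
  nlinarith [norm_nonneg (cotKernel g)]

/-- All values of `cotKernel` have real part -1/2 and the cotangent decreases on (0, π), so the
norms of the increments along a monotone sequence telescope. -/
lemma norm_cotKernel_sub {g g' : ℝ} (h0 : 0 < g) (h : g ≤ g') (h1 : g' < 1) :
    ‖cotKernel g' - cotKernel g‖ =
      Real.cos (Real.pi * g) / (2 * Real.sin (Real.pi * g))
      - Real.cos (Real.pi * g') / (2 * Real.sin (Real.pi * g')) := by
  have hpi := Real.pi_pos
  have hs : 0 < Real.sin (Real.pi * g) :=
    Real.sin_pos_of_pos_of_lt_pi (by positivity) (by nlinarith)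
  have hs' : 0 < Real.sin (Real.pi * g') :=
    Real.sin_pos_of_pos_of_lt_pi (by have := h0.trans_le h; positivity) (by nlinarith)
  have hd : 0 ≤ Real.sin (Real.pi * g' - Real.pi * g) :=
    Real.sin_nonneg_of_nonneg_of_le_pi (by nlinarith) (by nlinarith)
  rw [Real.sin_sub] at hd
  have e : cotKernel g' - cotKernel g =
      ((Real.cos (Real.pi * g) / (2 * Real.sin (Real.pi * g))
      - Real.cos (Real.pi * g') / (2 * Real.sin (Real.pi * g')) : ℝ) : ℂ) * Complex.I := by
    unfold cotKernel
    push_cast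
    ring
  rw [e, norm_mul, Complex.norm_I, mul_one, Complex.norm_real, Real.norm_eq_abs, abs_of_nonneg]
  rw [sub_nonneg, div_le_div_iff₀ (by positivity) (by positivity)]
  nlinarith

/-- Summation by parts against the differences `E (n+1) - E n`. -/
lemma sum_mul_sub_by_parts (c E : ℕ → ℂ) (m : ℕ) :
    ∑ n ∈ Finset.range (m + 1), c n * (E (n + 1) - E n) =
      c m * E (m + 1) - c 0 * E 0 - ∑ n ∈ Finset.range m, (c (n + 1) - c n) * E (n + 1) := by
  induction m with
  | zero => simp; ring
  | succ k ih => rw [Finset.sum_range_succ, ih, Finset.sum_range_succ _ k]; ring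

lemma half_cot_le {δ g : ℝ} (h1 : δ ≤ g) (h2 : g ≤ 1 - δ) (h0 : 0 < δ) :
    |Real.cos (Real.pi * g) / (2 * Real.sin (Real.pi * g))| ≤ 1 / (4 * δ) := by
  have hs := two_mul_le_sin_pi_mul h1 h2 h0
  have hp : 0 < 2 * Real.sin (Real.pi * g) := by linarith
  rw [abs_div, abs_of_pos hp]
  exact div_le_div₀ zero_le_one (Real.abs_cos_le_one _) (by positivity) (by linarith)

/-- The Kusmin–Landau inequality for differences in `[δ, 1 - δ]`. -/
lemma kusmin_landau_range (x : ℕ → ℝ) (L : ℕ) {δ : ℝ} (h0 : 0 < δ)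
    (h1 : ∀ n < L, δ ≤ x (n + 1) - x n) (h2 : ∀ n < L, x (n + 1) - x n ≤ 1 - δ)
    (hmono : ∀ n, n + 1 < L → x (n + 1) - x n ≤ x (n + 2) - x (n + 1)) :
    ‖∑ n ∈ Finset.range L, unitPhase (x n)‖ ≤ 1 / δ := by
  rcases L with _ | m
  · simp; positivity
  set g : ℕ → ℝ := fun n => x (n + 1) - x n with hg
  -- Each term becomes a multiple of a difference of consecutive terms, ready for summation by
  -- parts.
  have hE : ∀ n ∈ Finset.range (m + 1), unitPhase (x n) =
      cotKernel (g n) * (unitPhase (x (n + 1)) - unitPhase (x n)) := by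
    intro n hn
    have hn := Finset.mem_range.1 hn
    have e : unitPhase (x (n + 1)) = unitPhase (x n) * unitPhase (g n) := by
      rw [← unitPhase_add]; congr 1; simp [hg]
    have hs := two_mul_le_sin_pi_mul (h1 n hn) (h2 n hn) h0
    have := cotKernel_mul (g := g n) (by simp only [hg]; linarith)
    rw [e]
    linear_combination (-unitPhase (x n)) * this
  rw [Finset.sum_congr rfl hE,
    sum_mul_sub_by_parts (fun n => cotKernel (g n)) (fun n => unitPhase (x n))]
  have hb : ‖∑ n ∈ Finset.range m, (cotKernel (g (n + 1)) - cotKernel (g n))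
      * unitPhase (x (n + 1))‖ ≤ 1 / (4 * δ) + 1 / (4 * δ) := by
    refine (norm_sum_le _ _).trans ?_
    have : ∀ n ∈ Finset.range m, ‖(cotKernel (g (n + 1)) - cotKernel (g n))
        * unitPhase (x (n + 1))‖ = Real.cos (Real.pi * g n) / (2 * Real.sin (Real.pi * g n))
      - Real.cos (Real.pi * g (n + 1)) / (2 * Real.sin (Real.pi * g (n + 1))) := by
      intro n hn
      have hn := Finset.mem_range.1 hn
      rw [norm_mul, norm_unitPhase, mul_one]
      refine norm_cotKernel_sub (h0.trans_le (h1 n (by omega))) (hmono n (by omega)) ?_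
      have := h2 (n + 1) (by omega)
      simp only [hg]
      linarith
    rw [Finset.sum_congr rfl this, Finset.sum_range_sub'
      (fun n => Real.cos (Real.pi * g n) / (2 * Real.sin (Real.pi * g n)))]
    have a := abs_le.1 (half_cot_le (h1 0 (by omega)) (h2 0 (by omega)) h0)
    have b := abs_le.1 (half_cot_le (h1 m (by omega)) (h2 m (by omega)) h0)
    linarith [a.2, b.1]
  have b1 := norm_cotKernel_le (h1 0 (by omega)) (h2 0 (by omega)) h0
  have b2 := norm_cotKernel_le (h1 m (by omega)) (h2 m (by omega)) h0
  refine (norm_sub_le _ _).trans ((add_le_add (norm_sub_le _ _) hb).trans ?_)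
  rw [norm_mul, norm_mul, norm_unitPhase, norm_unitPhase, mul_one, mul_one]
  -- Two boundary terms and the two ends of the telescoped variation contribute 1/(4δ) each.
  have : 1 / δ = 1 / (4 * δ) + 1 / (4 * δ) + (1 / (4 * δ) + 1 / (4 * δ)) := by
    field_simp
    norm_num
  rw [this]
  gcongr

/-- Subtracting nk from the n-th phase leaves the character unchanged and moves the differences into
[δ, 1 - δ]. -/
lemma kusmin_landau (x : ℕ → ℝ) {a b : ℕ} {δ : ℝ} (h0 : 0 < δ) (k : ℤ)
    (h1 : ∀ n, a ≤ n → n < b → k + δ ≤ x (n + 1) - x n)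
    (h2 : ∀ n, a ≤ n → n < b → x (n + 1) - x n ≤ k + 1 - δ)
    (hmono : ∀ n, a ≤ n → n + 1 < b → x (n + 1) - x n ≤ x (n + 2) - x (n + 1)) :
    ‖∑ n ∈ Finset.Ico a b, unitPhase (x n)‖ ≤ 1 / δ := by
  rw [Finset.sum_Ico_eq_sum_range]
  have e : ∀ n ∈ Finset.range (b - a), unitPhase (x (a + n)) =
      unitPhase ((fun n : ℕ => x (a + n) - (n : ℝ) * k) n) := by
    intro n _
    have : x (a + n) = (x (a + n) - (n : ℝ) * k) + (((n : ℤ) * k : ℤ) : ℝ) := by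
      push_cast; ring
    rw [this, unitPhase_add, unitPhase_intCast, mul_one]
  rw [Finset.sum_congr rfl e]
  apply kusmin_landau_range _ _ h0
  · intro n hn
    have := h1 (a + n) (by omega) (by omega)
    push_cast
    rw [← add_assoc]
    linarith
  · intro n hn
    have := h2 (a + n) (by omega) (by omega)
    push_cast
    rw [← add_assoc]
    linarith
  · intro n hn
    have := hmono (a + n) (by omega) (by omega)
    push_cast
    rw [← add_assoc, ← add_assoc]
    linarith

/-! ### The second-difference test -/

/-- A monotone sequence crosses a threshold once. -/
lemma exists_threshold (g : ℕ → ℝ) (c : ℝ) {a b : ℕ} (hab : a ≤ b)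
    (hmono : ∀ n, a ≤ n → n + 1 < b → g n ≤ g (n + 1)) :
    ∃ p, a ≤ p ∧ p ≤ b ∧ (∀ n, a ≤ n → n < p → g n < c) ∧ ∀ n, p ≤ n → n < b → c ≤ g n := by
  induction b, hab using Nat.le_induction with
  | base => exact ⟨a, le_rfl, le_rfl, fun n _ _ => by omega, fun n _ _ => by omega⟩
  | succ b hab ih =>
    obtain ⟨p, hp1, hp2, hp3, hp4⟩ := ih fun n h1 h2 => hmono n h1 (by omega)
    by_cases hpb : p = b
    · subst hpb
      by_cases hc : g p < c
      · refine ⟨p + 1, by omega, le_rfl, fun n h1 h2 => ?_, fun n _ _ => by omega⟩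
        rcases Nat.lt_succ_iff_lt_or_eq.1 h2 with h | h
        · exact hp3 n h1 h
        · rwa [h]
      · refine ⟨p, hp1, by omega, hp3, fun n h1 h2 => ?_⟩
        have : n = p := by omega
        rw [this]; linarith
    · refine ⟨p, hp1, by omega, hp3, fun n h1 h2 => ?_⟩
      rcases Nat.lt_succ_iff_lt_or_eq.1 h2 with h | h
      · exact hp4 n h1 h
      · have h3 := hp4 (b - 1) (by omega) (by omega)
        have h4 := hmono (b - 1) (by omega) (by omega)
        rw [show b - 1 + 1 = b by omega] at h4
        rw [h]; linarith

lemma mul_sub_le_of_gap (g : ℕ → ℝ) {a b : ℕ} {lam : ℝ}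
    (hgap : ∀ n, a ≤ n → n + 1 < b → lam ≤ g (n + 1) - g n) (d : ℕ) (hd : a + d < b) :
    lam * d ≤ g (a + d) - g a := by
  induction d with
  | zero => simp
  | succ d ih =>
    have h1 := ih (by omega)
    have h2 := hgap (a + d) (by omega) (by omega)
    rw [← add_assoc]
    push_cast
    linarith

lemma norm_sum_unitPhase_le (x : ℕ → ℝ) {a b : ℕ} (hab : a ≤ b) :
    ‖∑ n ∈ Finset.Ico a b, unitPhase (x n)‖ ≤ (b : ℝ) - a := by
  refine (norm_sum_le _ _).trans ?_
  simp [norm_unitPhase, Nat.cast_sub hab]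

/-- One unit window of differences, starting just below the integer `k`. -/
lemma norm_sum_le_of_window (x : ℕ → ℝ) {a b : ℕ} (hab : a ≤ b) {lam δ : ℝ} (hlam : 0 < lam)
    (hδ : 0 < δ) (k : ℤ)
    (hgap : ∀ n, a ≤ n → n + 1 < b → lam ≤ (x (n + 2) - x (n + 1)) - (x (n + 1) - x n))
    (h1 : ∀ n, a ≤ n → n < b → k - δ ≤ x (n + 1) - x n)
    (h2 : ∀ n, a ≤ n → n < b → x (n + 1) - x n ≤ k + 1 - δ) :
    ‖∑ n ∈ Finset.Ico a b, unitPhase (x n)‖ ≤ 2 * δ / lam + 1 + 1 / δ := by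
  -- Differences within δ of k are at most 2δ/lam + 1 in number, since they grow by at least lam;
  -- these terms are bounded trivially and the rest by Kusmin–Landau.
  obtain ⟨p, hp1, hp2, hp3, hp4⟩ := exists_threshold (fun n => x (n + 1) - x n) (k + δ) hab
    (fun n u v => by have := hgap n u v; show x (n + 1) - x n ≤ x (n + 2) - x (n + 1); linarith)
  rw [← Finset.sum_Ico_consecutive _ hp1 hp2]
  refine (norm_add_le _ _).trans (add_le_add ?_ ?_)
  · refine (norm_sum_unitPhase_le x hp1).trans ?_
    rcases hp1.eq_or_lt with h | h
    · rw [h]; simp; positivity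
    · have := mul_sub_le_of_gap (fun n => x (n + 1) - x n) (a := a) (b := p) (lam := lam)
        (fun n u v => hgap n u (by omega)) (p - 1 - a) (by omega)
      have h3 := hp3 (a + (p - 1 - a)) (by omega) (by omega)
      have h4 := h1 a le_rfl (by omega)
      have e : ((p - 1 - a : ℕ) : ℝ) = (p : ℝ) - 1 - a := by
        rw [Nat.cast_sub (by omega), Nat.cast_sub (by omega)]; simp
      rw [e] at this
      have : (p : ℝ) - 1 - a ≤ 2 * δ / lam := by
        rw [le_div_iff₀ hlam]
        linarith
      linarith
  · refine kusmin_landau x hδ k hp4 (fun n u v => h2 n (by omega) v) fun n u v => ?_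
    have := hgap n (by omega) v
    linarith

/-- Windows are peeled off one at a time. The strict upper bound forces an empty range when no
window is left. -/
lemma norm_sum_le_of_windows (x : ℕ → ℝ) {lam δ : ℝ} (hlam : 0 < lam) (hδ : 0 < δ)
    (m : ℕ) : ∀ (a b : ℕ) (k : ℤ), a ≤ b →
    (∀ n, a ≤ n → n + 1 < b → lam ≤ (x (n + 2) - x (n + 1)) - (x (n + 1) - x n)) →
    (∀ n, a ≤ n → n < b → k - δ ≤ x (n + 1) - x n) →
    (∀ n, a ≤ n → n < b → x (n + 1) - x n < k + m - δ) →
    ‖∑ n ∈ Finset.Ico a b, unitPhase (x n)‖ ≤ m * (2 * δ / lam + 1 + 1 / δ) := by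
  induction m with
  | zero =>
    intro a b k hab _ h1 h2
    rcases hab.eq_or_lt with h | h
    · simp [h]
    · have u := h1 a le_rfl h
      have v := h2 a le_rfl h
      simp at v
      linarith
  | succ m ih =>
    intro a b k hab hgap h1 h2
    obtain ⟨p, hp1, hp2, hp3, hp4⟩ := exists_threshold (fun n => x (n + 1) - x n) (k + 1 - δ) hab
      (fun n u v => by have := hgap n u v; show x (n + 1) - x n ≤ x (n + 2) - x (n + 1); linarith)
    rw [← Finset.sum_Ico_consecutive _ hp1 hp2]
    have A := norm_sum_le_of_window x hp1 hlam hδ k (fun n u v => hgap n u (by omega))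
      (fun n u v => h1 n u (by omega)) (fun n u v => (hp3 n u v).le)
    have B := ih p b (k + 1) hp2 (fun n u v => hgap n (by omega) v)
      (fun n u v => by push_cast; exact hp4 n u v)
      (fun n u v => by have := h2 n (by omega) v; push_cast at this ⊢; linarith)
    refine (norm_add_le _ _).trans ((add_le_add A B).trans (le_of_eq ?_))
    push_cast
    ring

/-- The second-difference test of van der Corput. -/
theorem norm_sum_le_of_second_difference (x : ℕ → ℝ) {a b : ℕ} (hab : a ≤ b) {lam P Q : ℝ}
    (hlam : 0 < lam) (hPQ : P ≤ Q)
    (hgap : ∀ n, a ≤ n → n + 1 < b → lam ≤ (x (n + 2) - x (n + 1)) - (x (n + 1) - x n))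
    (h1 : ∀ n, a ≤ n → n < b → P ≤ x (n + 1) - x n)
    (h2 : ∀ n, a ≤ n → n < b → x (n + 1) - x n ≤ Q) :
    ‖∑ n ∈ Finset.Ico a b, unitPhase (x n)‖ ≤ (Q - P + 2) * (3 / √lam + 1) := by
  have hs : 0 < √lam := Real.sqrt_pos.2 hlam
  -- This choice gives 2δ/lam and 1/δ the same order. A large δ does no harm: for δ > 1/2 the
  -- Kusmin–Landau range is empty.
  set δ := √lam with hδ
  have hk := Int.floor_mono (show P + δ ≤ Q + δ by linarith)
  -- The number of windows, starting at ⌊P + δ⌋, that cover [P, Q]; it is at most Q - P + 2.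
  obtain ⟨m, hm⟩ : ∃ m : ℕ, (m : ℤ) = ⌊Q + δ⌋ - ⌊P + δ⌋ + 1 := ⟨_, Int.toNat_of_nonneg (by omega)⟩
  have hm' : (m : ℝ) = ⌊Q + δ⌋ - ⌊P + δ⌋ + 1 := by exact_mod_cast hm
  have q1 := Int.floor_le (P + δ)
  have q2 := Int.lt_floor_add_one (P + δ)
  have q3 := Int.floor_le (Q + δ)
  have q4 := Int.lt_floor_add_one (Q + δ)
  refine (norm_sum_le_of_windows x hlam hs m a b ⌊P + δ⌋ hab hgap
    (fun n u v => by have := h1 n u v; linarith)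
    (fun n u v => by have := h2 n u v; rw [hm']; linarith)).trans ?_
  have e : 2 * δ / lam + 1 + 1 / δ = 3 / δ + 1 := by
    have : lam = δ * δ := (Real.mul_self_sqrt hlam.le).symm
    rw [this]; field_simp; ring
  rw [e]
  gcongr
  linarith

/-! ### The Weyl–van der Corput inequality -/

/-- Translating the summation variable does not change the sum of a function supported in
`[a, b)`, as long as the translated range covers the support. -/
lemma sum_shift_of_support {f : ℕ → ℂ} {a b H r : ℕ} (hHa : H ≤ a) (hr : r < H)
    (hf : ∀ n, n ∉ Finset.Ico a b → f n = 0) :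
    ∑ m ∈ Finset.Ico (a + 1 - H) b, f (m + r) = ∑ n ∈ Finset.Ico a b, f n := by
  rw [Finset.sum_Ico_add' f]
  symm
  apply Finset.sum_subset
  · intro n hn
    rw [Finset.mem_Ico] at hn ⊢
    omega
  · intro n _ hn
    exact hf n hn

/-- A weight depending on the distance of two indices, with the value `d` on the diagonal. -/
noncomputable def distWeight (d : ℝ) (B : ℕ → ℝ) (r r' : ℕ) : ℝ :=
  if r' < r then B (r - r') else if r' = r then d else B (r' - r)

/-- Every distance h ≥ 1 from r occurs at most twice, once on each side. -/
lemma sum_distWeight_le (d : ℝ) {B : ℕ → ℝ} {H r : ℕ} (hr : r < H)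
    (hB : ∀ h, 1 ≤ h → h < H → 0 ≤ B h) :
    ∑ r' ∈ Finset.range H, distWeight d B r r' ≤ d + 2 * ∑ h ∈ Finset.Ico 1 H, B h := by
  have hsub : ∀ k, k ≤ H → ∑ h ∈ Finset.Ico 1 k, B h ≤ ∑ h ∈ Finset.Ico 1 H, B h := by
    intro k hk
    apply Finset.sum_le_sum_of_subset_of_nonneg
    · exact Finset.Ico_subset_Ico_right hk
    · intro h hh _
      rw [Finset.mem_Ico] at hh
      exact hB h hh.1 hh.2
  rw [Finset.range_eq_Ico, ← Finset.sum_Ico_consecutive _ (Nat.zero_le r) hr.le,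
    Finset.sum_eq_sum_Ico_succ_bot hr]
  have e1 : ∑ r' ∈ Finset.Ico 0 r, distWeight d B r r' = ∑ h ∈ Finset.Ico 1 (r + 1), B h := by
    refine Finset.sum_nbij' (fun r' => r - r') (fun h => r - h) ?_ ?_ ?_ ?_ ?_ <;>
      intro n hn <;> rw [Finset.mem_Ico] at hn
    · rw [Finset.mem_Ico]; omega
    · rw [Finset.mem_Ico]; omega
    · omega
    · omega
    · rw [distWeight, if_pos hn.2]
  have e2 : ∑ r' ∈ Finset.Ico (r + 1) H, distWeight d B r r' =
      ∑ h ∈ Finset.Ico 1 (H - r), B h := by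
    refine Finset.sum_nbij' (fun r' => r' - r) (fun h => r + h) ?_ ?_ ?_ ?_ ?_ <;>
      intro n hn <;> rw [Finset.mem_Ico] at hn
    · rw [Finset.mem_Ico]; omega
    · rw [Finset.mem_Ico]; omega
    · omega
    · omega
    · rw [distWeight, if_neg (by omega), if_neg (by omega)]
  have e3 : distWeight d B r r = d := by simp [distWeight]
  rw [e1, e2, e3]
  linarith [hsub (r + 1) (by omega), hsub (H - r) (by omega)]

/-- The Weyl–van der Corput inequality. -/
theorem weyl_van_der_corput {z : ℕ → ℂ} {a L H : ℕ} (hHa : H ≤ a) (hH : 1 ≤ H)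
    (hz : ∀ n, ‖z n‖ ≤ 1)
    (hz0 : ∀ n, n ∉ Finset.Ico a (a + L) → z n = 0) {B : ℕ → ℝ}
    (hB : ∀ h, 1 ≤ h → h < H →
      ‖∑ n ∈ Finset.Ico a (a + L), z n * (starRingEnd ℂ) (z (n + h))‖ ≤ B h) :
    H * ‖∑ n ∈ Finset.Ico a (a + L), z n‖ ^ 2 ≤
      (L + H) * (L + 2 * ∑ h ∈ Finset.Ico 1 H, B h) := by
  set S := ∑ n ∈ Finset.Ico a (a + L), z n with hS
  set R := Finset.Ico (a + 1 - H) (a + L) with hR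
  have hB0 : ∀ h, 1 ≤ h → h < H → 0 ≤ B h := fun h h1 h2 => (norm_nonneg _).trans (hB h h1 h2)
  have hHS : (H : ℂ) * S = ∑ m ∈ R, ∑ r ∈ Finset.range H, z (m + r) := by
    rw [Finset.sum_comm, Finset.sum_congr rfl fun r hr =>
      sum_shift_of_support hHa (Finset.mem_range.1 hr) hz0]
    simp [hS]
  -- As z vanishes off the block, a correlation of two shifts depends only on their distance.
  have hcorr : ∀ h r, r + h < H → ∑ m ∈ R, z (m + r) * (starRingEnd ℂ) (z (m + (r + h))) =
      ∑ n ∈ Finset.Ico a (a + L), z n * (starRingEnd ℂ) (z (n + h)) := by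
    intro h r hr
    rw [← sum_shift_of_support (f := fun n => z n * (starRingEnd ℂ) (z (n + h)))
      (r := r) hHa (by omega) (fun n hn => by simp [hz0 n hn])]
    simp only [add_assoc]
    rfl
  have hpair : ∀ r ∈ Finset.range H, ∀ r' ∈ Finset.range H,
      ‖∑ m ∈ R, z (m + r) * (starRingEnd ℂ) (z (m + r'))‖ ≤ distWeight L B r r' := by
    intro r hr r' hr'
    rw [Finset.mem_range] at hr hr'
    unfold distWeight
    split_ifs with h1 h2
    · have := hcorr (r - r') r' (by omega)
      rw [show r' + (r - r') = r by omega] at this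
      have e : ∑ m ∈ R, z (m + r) * (starRingEnd ℂ) (z (m + r')) =
          (starRingEnd ℂ) (∑ m ∈ R, z (m + r') * (starRingEnd ℂ) (z (m + r))) := by
        rw [map_sum]
        refine Finset.sum_congr rfl fun m _ => ?_
        rw [map_mul, Complex.conj_conj, mul_comm]
      rw [e, this, RCLike.norm_conj]
      exact hB _ (by omega) (by omega)
    · rw [h2]
      have := hcorr 0 r (by omega)
      rw [add_zero] at this
      rw [this]
      refine (norm_sum_le _ _).trans ?_
      refine (Finset.sum_le_card_nsmul _ _ 1 fun n _ => ?_).trans (by simp)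
      rw [norm_mul, RCLike.norm_conj, add_zero]
      exact mul_le_one₀ (hz n) (norm_nonneg _) (hz n)
    · have := hcorr (r' - r) r (by omega)
      rw [show r + (r' - r) = r' by omega] at this
      rw [this]
      exact hB _ (by omega) (by omega)
  have hsq : ∑ m ∈ R, ‖∑ r ∈ Finset.range H, z (m + r)‖ ^ 2 ≤
      H * (L + 2 * ∑ h ∈ Finset.Ico 1 H, B h) := by
    have e : ((∑ m ∈ R, ‖∑ r ∈ Finset.range H, z (m + r)‖ ^ 2 : ℝ) : ℂ) =
        ∑ r ∈ Finset.range H, ∑ r' ∈ Finset.range H,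
          ∑ m ∈ R, z (m + r) * (starRingEnd ℂ) (z (m + r')) := by
      rw [Finset.sum_congr rfl fun r _ => Finset.sum_comm, Finset.sum_comm]
      push_cast
      refine Finset.sum_congr rfl fun m _ => ?_
      rw [← Complex.mul_conj', map_sum, Finset.sum_mul_sum]
    have h0 : 0 ≤ ∑ m ∈ R, ‖∑ r ∈ Finset.range H, z (m + r)‖ ^ 2 := by positivity
    rw [← abs_of_nonneg h0, ← Real.norm_eq_abs, ← Complex.norm_real, e]
    refine (norm_sum_le _ _).trans ?_
    refine (Finset.sum_le_card_nsmul _ _ _ fun r hr => ?_).trans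
      (le_of_eq (by rw [Finset.card_range, nsmul_eq_mul]))
    refine (norm_sum_le _ _).trans ((Finset.sum_le_sum fun r' hr' => hpair r hr r' hr').trans ?_)
    exact sum_distWeight_le _ (Finset.mem_range.1 hr) hB0
  -- Cauchy–Schwarz over R, which has L + H - 1 elements; H ≤ a keeps the natural subtraction in R
  -- from truncating.
  have hcs : (H * ‖S‖) ^ 2 ≤ (L + H) * ∑ m ∈ R, ‖∑ r ∈ Finset.range H, z (m + r)‖ ^ 2 := by
    have e : (H : ℝ) * ‖S‖ = ‖(H : ℂ) * S‖ := by simp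
    rw [e, hHS]
    have h1 := norm_sum_le R fun m => ∑ r ∈ Finset.range H, z (m + r)
    have h2 := sq_sum_le_card_mul_sum_sq (s := R)
      (f := fun m => ‖∑ r ∈ Finset.range H, z (m + r)‖)
    refine (pow_le_pow_left₀ (norm_nonneg _) h1 2).trans (h2.trans ?_)
    gcongr
    rw [hR, Nat.card_Ico]
    have : a + L - (a + 1 - H) ≤ L + H := by omega
    exact_mod_cast this
  have hHpos : (0 : ℝ) < H := by exact_mod_cast hH
  have h3 := hcs.trans (mul_le_mul_of_nonneg_left hsq (by positivity))
  refine le_of_mul_le_mul_left ?_ hHpos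
  linarith

/-! ### Finite differences of the logarithm -/

/-- Each difference of logarithms below is the logarithm of a rational function of n, so log u ≤ u -
1 bounds it, from below after inverting the quotient. -/
lemma log_sub_log_le {x y : ℝ} (hx : 0 < x) (hy : 0 < y) :
    Real.log x - Real.log y ≤ x / y - 1 := by
  rw [← Real.log_div hx.ne' hy.ne']
  exact Real.log_le_sub_one_of_pos (by positivity)

/-- The first difference of the logarithm at a natural number. -/
noncomputable def logDiff (n : ℕ) : ℝ := Real.log (n + 1 : ℕ) - Real.log n

lemma logDiff_nonneg {n : ℕ} (hn : 1 ≤ n) : 0 ≤ logDiff n := by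
  have : (0 : ℝ) < n := by exact_mod_cast hn
  rw [logDiff, sub_nonneg]
  exact Real.log_le_log this (by push_cast; linarith)

lemma logDiff_le {n : ℕ} (hn : 1 ≤ n) : logDiff n ≤ 1 / n := by
  have h : (0 : ℝ) < n := by exact_mod_cast hn
  refine (log_sub_log_le (by positivity) h).trans (le_of_eq ?_)
  push_cast
  field_simp
  ring

lemma logDiff_sub_le {n : ℕ} (hn : 1 ≤ n) : logDiff n - logDiff (n + 1) ≤ 1 / (n : ℝ) ^ 2 := by
  have h : (0 : ℝ) < n := by exact_mod_cast hn
  have := log_sub_log_le (x := ((n : ℝ) + 1) ^ 2) (y := n * (n + 2)) (by positivity)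
    (by positivity)
  rw [Real.log_pow, Real.log_mul (by positivity) (by positivity)] at this
  unfold logDiff
  push_cast at this ⊢
  have e : ((n : ℝ) + 1) ^ 2 / (n * (n + 2)) - 1 ≤ 1 / (n : ℝ) ^ 2 := by
    rw [sub_le_iff_le_add, div_le_iff₀ (by positivity)]
    field_simp
    nlinarith
  rw [show (n : ℝ) + 1 + 1 = n + 2 by ring]
  linarith

lemma le_logDiff_sub {n : ℕ} (hn : 1 ≤ n) :
    1 / ((n : ℝ) + 1) ^ 2 ≤ logDiff n - logDiff (n + 1) := by
  have h : (0 : ℝ) < n := by exact_mod_cast hn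
  have := log_sub_log_le (y := ((n : ℝ) + 1) ^ 2) (x := n * (n + 2)) (by positivity)
    (by positivity)
  rw [Real.log_pow, Real.log_mul (by positivity) (by positivity)] at this
  unfold logDiff
  push_cast at this ⊢
  have e : 1 - (n * (n + 2) : ℝ) / ((n : ℝ) + 1) ^ 2 = 1 / ((n : ℝ) + 1) ^ 2 := by
    field_simp
    ring
  rw [show (n : ℝ) + 1 + 1 = n + 2 by ring]
  linarith

lemma logDiff_antitone {m n : ℕ} (hm : 1 ≤ m) (hmn : m ≤ n) : logDiff n ≤ logDiff m := by
  induction n, hmn using Nat.le_induction with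
  | base => exact le_rfl
  | succ n hmn ih =>
    have := le_logDiff_sub (hm.trans hmn)
    have : 0 ≤ 1 / ((n : ℝ) + 1) ^ 2 := by positivity
    linarith

/-- A lower bound for the third difference of the logarithm. -/
lemma le_third_difference_log {n : ℕ} (hn : 1 ≤ n) :
    2 / ((n : ℝ) + 2) ^ 3 ≤
      (logDiff n - logDiff (n + 1)) - (logDiff (n + 1) - logDiff (n + 2)) := by
  have h : (0 : ℝ) < n := by exact_mod_cast hn
  have := log_sub_log_le (y := ((n : ℝ) + 3) * (n + 1) ^ 3) (x := (n + 2) ^ 3 * n) (by positivity)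
    (by positivity)
  rw [Real.log_mul (by positivity) (by positivity), Real.log_mul (by positivity) (by positivity),
    Real.log_pow, Real.log_pow] at this
  unfold logDiff
  push_cast at this ⊢
  have e : 2 / ((n : ℝ) + 2) ^ 3 ≤ 1 - ((n : ℝ) + 2) ^ 3 * n / ((n + 3) * (n + 1) ^ 3) := by
    have h1 : 1 - ((n : ℝ) + 2) ^ 3 * n / ((n + 3) * (n + 1) ^ 3) =
        (2 * n + 3) / ((n + 3) * (n + 1) ^ 3) := by
      field_simp
      ring
    rw [h1, div_le_div_iff₀ (by positivity) (by positivity)]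
    have : 0 ≤ 3 * (n : ℝ) ^ 3 + 18 * n ^ 2 + 32 * n + 18 := by positivity
    nlinarith
  rw [show (n : ℝ) + 1 + 1 = n + 2 by ring, show (n : ℝ) + 2 + 1 = n + 3 by ring]
  linarith

lemma logDiff_sub_shift_le {a n : ℕ} (ha : 1 ≤ a) (han : a ≤ n) (h : ℕ) :
    logDiff n - logDiff (n + h) ≤ h / (a : ℝ) ^ 2 := by
  have h0 : (0 : ℝ) < a := by exact_mod_cast ha
  induction h with
  | zero => simp
  | succ h ih =>
    have h1 := logDiff_sub_le (n := n + h) (by omega)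
    have h2 : 1 / ((n + h : ℕ) : ℝ) ^ 2 ≤ 1 / (a : ℝ) ^ 2 := by
      gcongr
      omega
    rw [← add_assoc]
    push_cast at *
    rw [add_div]
    linarith

/-- A sum of h third differences, each at least 2/b³. -/
lemma le_second_difference_shift {n b : ℕ} (hn : 1 ≤ n) (h : ℕ) (hb : n + h + 1 ≤ b) :
    2 * h / (b : ℝ) ^ 3 ≤
      (logDiff n - logDiff (n + 1)) - (logDiff (n + h) - logDiff (n + h + 1)) := by
  induction h with
  | zero => simp
  | succ h ih =>
    have h1 := ih (by omega)
    have h2 := le_third_difference_log (n := n + h) (by omega)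
    have h3 : 2 / (b : ℝ) ^ 3 ≤ 2 / (((n + h : ℕ) : ℝ) + 2) ^ 3 := by
      gcongr
      have : n + h + 2 ≤ b := by omega
      exact_mod_cast this
    have e : 2 * ((h + 1 : ℕ) : ℝ) / (b : ℝ) ^ 3 = 2 * h / (b : ℝ) ^ 3 + 2 / (b : ℝ) ^ 3 := by
      push_cast
      ring
    rw [e, show n + (h + 1) = n + h + 1 by ring, show n + h + 1 + 1 = n + h + 2 by ring]
    linarith

/-! ### Exponential sums with phase τ log n on dyadic blocks -/

/-- The second-difference test for `n ↦ exp(-2πi τ log n)` on a dyadic block. -/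
lemma norm_sum_log_le_second {τ : ℝ} (hτ : 0 < τ) {N M : ℕ} (hN : 1 ≤ N) (hNM : N ≤ M)
    (hM : M ≤ 2 * N) :
    ‖∑ n ∈ Finset.Ioc N M, unitPhase (-τ * Real.log n)‖ ≤
      (τ / N + 2) * (6 * N / √τ + 1) := by
  have hN0 : (0 : ℝ) < N := by exact_mod_cast hN
  have hx : ∀ n : ℕ, -τ * Real.log (n + 1 : ℕ) - -τ * Real.log n = -τ * logDiff n := by
    intro n; unfold logDiff; ring
  have hset : Finset.Ioc N M = Finset.Ico (N + 1) (M + 1) := by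
    ext; simp only [Finset.mem_Ioc, Finset.mem_Ico]; omega
  have := norm_sum_le_of_second_difference (fun n : ℕ => -τ * Real.log n)
    (a := N + 1) (b := M + 1) (lam := τ / (2 * N) ^ 2) (P := -τ * (1 / N)) (Q := 0)
    (by omega) (by positivity) (by have : 0 ≤ τ * (1 / (N : ℝ)) := by positivity
                                   linarith) ?_ ?_ ?_
  · rw [hset]
    refine this.trans (le_of_eq ?_)
    rw [Real.sqrt_div hτ.le, Real.sqrt_sq (by positivity)]
    field_simp
    ring
  · intro n h1 h2
    rw [hx, hx n]
    have h3 := le_logDiff_sub (n := n) (by omega)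
    have h4 : 1 / (2 * (N : ℝ)) ^ 2 ≤ 1 / ((n : ℝ) + 1) ^ 2 := by
      gcongr
      have : n + 1 ≤ 2 * N := by omega
      exact_mod_cast this
    rw [div_eq_mul_one_div]
    nlinarith
  · intro n h1 h2
    rw [hx]
    have h3 := logDiff_le (n := n) (by omega)
    have h4 : 1 / (n : ℝ) ≤ 1 / N := by
      gcongr
      omega
    nlinarith
  · intro n h1 h2
    rw [hx]
    nlinarith [logDiff_nonneg (n := n) (by omega)]

/-- The second-difference test for the shifted correlations of `n ↦ exp(-2πi τ log n)`. -/
lemma norm_sum_correlation_le {τ : ℝ} (hτ : 0 < τ) {N L h : ℕ} (hN : 1 ≤ N) (hL : L ≤ N)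
    (hh : 1 ≤ h) (hhL : h ≤ L) :
    ‖∑ n ∈ Finset.Ico (N + 1) (N + 1 + L - h),
      unitPhase (τ * (Real.log (n + h : ℕ) - Real.log n))‖ ≤
      (h * τ / N ^ 2 + 2) * (6 * N * √N / (√τ * √h) + 1) := by
  have hN0 : (0 : ℝ) < N := by exact_mod_cast hN
  have hh0 : (0 : ℝ) < h := by exact_mod_cast hh
  have hx : ∀ n : ℕ, τ * (Real.log (n + 1 + h : ℕ) - Real.log (n + 1 : ℕ))
      - τ * (Real.log (n + h : ℕ) - Real.log n) = -τ * (logDiff n - logDiff (n + h)) := by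
    intro n; unfold logDiff
    rw [show n + 1 + h = n + h + 1 by ring]
    ring
  -- Stopping at N + L - h keeps n + h within 2N, so b = 2N is admissible in
  -- `le_second_difference_shift` and gives this lam.
  have := norm_sum_le_of_second_difference
    (fun n : ℕ => τ * (Real.log (n + h : ℕ) - Real.log n))
    (a := N + 1) (b := N + 1 + L - h) (lam := τ * (2 * h / (2 * N : ℕ) ^ 3))
    (P := -τ * (h / N ^ 2)) (Q := 0)
    (by omega) (by positivity) (by have : 0 ≤ τ * (h / (N : ℝ) ^ 2) := by positivity
                                   linarith) ?_ ?_ ?_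
  · refine this.trans (le_of_eq ?_)
    have e : √(τ * (2 * h / ((2 * N : ℕ) : ℝ) ^ 3)) = √τ * √h / (2 * N * √N) := by
      rw [Real.sqrt_eq_iff_mul_self_eq (by positivity) (by positivity)]
      push_cast
      have h1 := Real.mul_self_sqrt hτ.le
      have h2 := Real.mul_self_sqrt hh0.le
      have h3 := Real.mul_self_sqrt hN0.le
      have h4 : √τ * √h / (2 * N * √N) * (√τ * √h / (2 * N * √N)) =
        (√τ * √τ) * (√h * √h) / (4 * N ^ 2 * (√N * √N)) := by ring
      rw [h4, h1, h2, h3]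
      field_simp
      ring
    rw [e]
    field_simp
    ring
  · intro n h1 h2
    rw [hx, hx n]
    have h3 := le_second_difference_shift (n := n) (b := 2 * N) (by omega) h (by omega)
    rw [show n + 1 + h = n + h + 1 by ring]
    nlinarith
  · intro n h1 h2
    rw [hx]
    have h3 := logDiff_sub_shift_le (n := n) hN (by omega) h
    nlinarith
  · intro n h1 h2
    rw [hx]
    nlinarith [logDiff_antitone (m := n) (n := n + h) (by omega) (by omega)]

lemma sum_inv_sqrt_le (H : ℕ) : ∑ h ∈ Finset.Ico 1 H, 1 / √(h : ℝ) ≤ 2 * √H := by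
  have key : ∀ n : ℕ, ∑ h ∈ Finset.Ico 1 (n + 1), 1 / √(h : ℝ) ≤ 2 * √n := by
    intro n
    induction n with
    | zero => simp
    | succ n ih =>
      rw [Finset.sum_Ico_succ_top (by omega)]
      have h1 : 0 < √((n + 1 : ℕ) : ℝ) := Real.sqrt_pos.2 (by positivity)
      have h2 := Real.mul_self_sqrt (show (0 : ℝ) ≤ n by positivity)
      have h3 := Real.mul_self_sqrt (show (0 : ℝ) ≤ (n + 1 : ℕ) by positivity)
      have h4 : 1 / √((n + 1 : ℕ) : ℝ) ≤ 2 * √((n + 1 : ℕ) : ℝ) - 2 * √n := by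
        rw [div_le_iff₀ h1]
        push_cast at *
        nlinarith [sq_nonneg (√((n : ℝ) + 1) - √n)]
      linarith
  rcases H with _ | n
  · simp
  · refine (key n).trans ?_
    gcongr
    simp

/-- The phases are extended by zero outside the block; only n with both n and n + h in the block
survive in a correlation, and none do when h > L. -/
lemma norm_sq_sum_log_le {τ : ℝ} (hτ : 0 < τ) {N L H : ℕ} (hN : 1 ≤ N) (hL : L ≤ N)
    (hH : 1 ≤ H) (hHN : H ≤ N) :
    H * ‖∑ n ∈ Finset.Ico (N + 1) (N + 1 + L), unitPhase (-τ * Real.log n)‖ ^ 2 ≤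
      (N + H) * (N + 2 * ∑ h ∈ Finset.Ico 1 H,
        (h * τ / N ^ 2 + 2) * (6 * N * √N / (√τ * √h) + 1)) := by
  set z : ℕ → ℂ := fun n =>
    if n ∈ Finset.Ico (N + 1) (N + 1 + L) then unitPhase (-τ * Real.log n) else 0 with hz
  have hnn : 0 ≤ ∑ h ∈ Finset.Ico 1 H,
        ((h : ℝ) * τ / N ^ 2 + 2) * (6 * N * √N / (√τ * √h) + 1) :=
    Finset.sum_nonneg fun h _ => by positivity
  have hS : ∑ n ∈ Finset.Ico (N + 1) (N + 1 + L), unitPhase (-τ * Real.log n) =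
      ∑ n ∈ Finset.Ico (N + 1) (N + 1 + L), z n :=
    Finset.sum_congr rfl fun n hn => by simp only [hz, if_pos hn]
  have hLN : (L : ℝ) ≤ N := by exact_mod_cast hL
  rw [hS]
  have key := weyl_van_der_corput (z := z) (a := N + 1) (L := L) (H := H)
    (B := fun h : ℕ => ((h : ℝ) * τ / N ^ 2 + 2) * (6 * N * √N / (√τ * √h) + 1)) (by omega) hH
    (fun n => ?_) (fun n hn => by simp only [hz, if_neg hn]) (fun h h1 h2 => ?_)
  · refine key.trans ?_
    gcongr
  · simp only [hz]
    split_ifs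
    · exact (norm_unitPhase _).le
    · simp
  · have e : ∑ n ∈ Finset.Ico (N + 1) (N + 1 + L), z n * (starRingEnd ℂ) (z (n + h)) =
        ∑ n ∈ Finset.Ico (N + 1) (N + 1 + L - h),
          unitPhase (τ * (Real.log (n + h : ℕ) - Real.log n)) := by
      symm
      refine Finset.sum_subset_zero_on_sdiff ?_ ?_ ?_
      · intro n hn
        rw [Finset.mem_Ico] at hn ⊢
        omega
      · intro n hn
        rw [Finset.mem_sdiff, Finset.mem_Ico, Finset.mem_Ico] at hn
        have : n + h ∉ Finset.Ico (N + 1) (N + 1 + L) := by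
          rw [Finset.mem_Ico]; omega
        simp only [hz, if_neg this, map_zero, mul_zero]
      · intro n hn
        rw [Finset.mem_Ico] at hn
        have h3 : n ∈ Finset.Ico (N + 1) (N + 1 + L) := by rw [Finset.mem_Ico]; omega
        have h4 : n + h ∈ Finset.Ico (N + 1) (N + 1 + L) := by rw [Finset.mem_Ico]; omega
        simp only [hz, if_pos h3, if_pos h4]
        rw [conj_unitPhase, ← unitPhase_add]
        congr 1
        ring
    rw [e]
    by_cases hhL : h ≤ L
    · exact norm_sum_correlation_le hτ hN hL h1 hhL
    · rw [Finset.Ico_eq_empty (by omega)]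
      simp only [Finset.sum_empty, norm_zero]
      positivity

/-- With τ = w^12 and N = q²w⁴ the roots of τ and N disappear. The parts increasing in h are
replaced by their value at H; only 1/√h is summed. -/
lemma sum_correlation_bound_le {w q : ℝ} (hw : 0 < w) (hq : 0 < q) {N H : ℕ}
    (hNq : (N : ℝ) = q ^ 2 * w ^ 4) :
    ∑ h ∈ Finset.Ico 1 H,
        ((h : ℝ) * w ^ 12 / N ^ 2 + 2) * (6 * N * √N / (√(w ^ 12) * √h) + 1) ≤
      H * (6 * w ^ 4 * √H / q + H * w ^ 4 / q ^ 4 + 2) + 24 * q ^ 3 * √H := by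
  have hsN : √(N : ℝ) = q * w ^ 2 := by
    rw [hNq, show q ^ 2 * w ^ 4 = (q * w ^ 2) ^ 2 by ring, Real.sqrt_sq (by positivity)]
  have hsw : √(w ^ 12) = w ^ 6 := by
    rw [show w ^ 12 = (w ^ 6) ^ 2 by ring, Real.sqrt_sq (by positivity)]
  rw [hsN, hsw, hNq]
  have hterm : ∀ h ∈ Finset.Ico 1 H, ((h : ℝ) * w ^ 12 / (q ^ 2 * w ^ 4) ^ 2 + 2) *
      (6 * (q ^ 2 * w ^ 4) * (q * w ^ 2) / (w ^ 6 * √h) + 1) ≤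
      (6 * w ^ 4 * √H / q + H * w ^ 4 / q ^ 4 + 2) + 12 * q ^ 3 * (1 / √h) := by
    intro h hh
    rw [Finset.mem_Ico] at hh
    have hh0 : (0 : ℝ) < h := by exact_mod_cast hh.1
    have hr : 0 < √(h : ℝ) := Real.sqrt_pos.2 hh0
    have hhH : (h : ℝ) ≤ H := by exact_mod_cast hh.2.le
    have e : ((h : ℝ) * w ^ 12 / (q ^ 2 * w ^ 4) ^ 2 + 2) *
      (6 * (q ^ 2 * w ^ 4) * (q * w ^ 2) / (w ^ 6 * √h) + 1) =
      (6 * w ^ 4 * √h / q + h * w ^ 4 / q ^ 4 + 2) + 12 * q ^ 3 * (1 / √h) := by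
      have h5 : (h : ℝ) = √h * √h := (Real.mul_self_sqrt hh0.le).symm
      generalize √(h : ℝ) = r at *
      rw [h5]
      field_simp
      ring
    rw [e]
    gcongr
  refine (Finset.sum_le_sum hterm).trans ?_
  rw [Finset.sum_add_distrib, ← Finset.mul_sum, Finset.sum_const, Nat.card_Ico, nsmul_eq_mul]
  have h1 := sum_inv_sqrt_le H
  have h2 : ((H - 1 : ℕ) : ℝ) ≤ H := by exact_mod_cast Nat.sub_le _ _
  have h3 : ((H - 1 : ℕ) : ℝ) * (6 * w ^ 4 * √H / q + H * w ^ 4 / q ^ 4 + 2) ≤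
      H * (6 * w ^ 4 * √H / q + H * w ^ 4 / q ^ 4 + 2) := by gcongr
  have h4 : 12 * q ^ 3 * ∑ h ∈ Finset.Ico 1 H, 1 / √(h : ℝ) ≤ 12 * q ^ 3 * (2 * √H) := by gcongr
  linarith

/-- The third-difference estimate on a dyadic block, with `τ = w ^ 12`. -/
theorem norm_sum_log_le_third {w : ℝ} (hw : 7 / 2 ≤ w) {N M : ℕ} (hN : 12 * w ^ 4 ≤ N)
    (hNM : N ≤ M) (hM : M ≤ 2 * N) :
    ‖∑ n ∈ Finset.Ioc N M, unitPhase (-w ^ 12 * Real.log n)‖ ≤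
      N * (3.4 * w ^ 2 / √N + 8.3 / w ^ 2) := by
  have hw0 : 0 < w := by linarith
  have hw4 : 150 ≤ w ^ 4 := by
    have : (7 / 2 : ℝ) ^ 4 ≤ w ^ 4 := by gcongr
    norm_num at this
    linarith
  have hN0 : (0 : ℝ) < N := by nlinarith
  have hN1 : 1 ≤ N := by exact_mod_cast hN0
  set q := √((N : ℝ) / w ^ 4) with hq
  have hq2 : q ^ 2 = N / w ^ 4 := Real.sq_sqrt (by positivity)
  have hq0 : 0 < q := Real.sqrt_pos.2 (by positivity)
  have hNq : (N : ℝ) = q ^ 2 * w ^ 4 := by rw [hq2]; field_simp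
  have hq12 : 12 ≤ q ^ 2 := by rw [hq2, le_div_iff₀ (by positivity)]; exact hN
  have hsN : √(N : ℝ) = q * w ^ 2 := by
    rw [hNq, show q ^ 2 * w ^ 4 = (q * w ^ 2) ^ 2 by ring, Real.sqrt_sq (by positivity)]
  -- With H of order q², both N/H and w⁴√H/q have order w⁴. As q² ≥ 12, rounding up costs at most
  -- q²/12.
  obtain ⟨H, hH⟩ : ∃ H, H = ⌈q ^ 2 / 2⌉₊ := ⟨_, rfl⟩
  have hH1 : q ^ 2 / 2 ≤ H := hH ▸ Nat.le_ceil _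
  have hH2 : (H : ℝ) ≤ 7 / 12 * q ^ 2 := by
    have := Nat.ceil_lt_add_one (show 0 ≤ q ^ 2 / 2 by positivity)
    rw [← hH] at this
    linarith
  have hH0 : (0 : ℝ) < H := by linarith
  have hHN : H ≤ N := by
    have : (H : ℝ) ≤ N := by rw [hNq]; nlinarith
    exact_mod_cast this
  have hset : Finset.Ioc N M = Finset.Ico (N + 1) (N + 1 + (M - N)) := by
    ext; simp only [Finset.mem_Ioc, Finset.mem_Ico]; omega
  have key := norm_sq_sum_log_le (τ := w ^ 12) (by positivity) hN1 (L := M - N) (by omega)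
    (by exact_mod_cast hH0) hHN
  have hsum := sum_correlation_bound_le hw0 hq0 hNq (H := H)
  rw [← hset] at key
  set S := ‖∑ n ∈ Finset.Ioc N M, unitPhase (-w ^ 12 * Real.log n)‖ with hS
  set s := √(H : ℝ) with hs
  have hs0 : 0 < s := Real.sqrt_pos.2 hH0
  have hs2 : s ^ 2 = H := Real.sq_sqrt hH0.le
  have hs_up : s ≤ 0.764 * q := by
    apply (sq_le_sq₀ (by positivity) (by positivity)).1
    nlinarith
  have hs_lo : q ≤ 1.4143 * s := by
    apply (sq_le_sq₀ (by positivity) (by positivity)).1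
    nlinarith
  have key2 : S ^ 2 ≤ (N + H) * (N / H + 12 * w ^ 4 * (s / q) + 2 * (H / q ^ 4) * w ^ 4 + 4
      + 48 * q ^ 3 / s) := by
    refine le_of_mul_le_mul_left ?_ hH0
    refine key.trans ((mul_le_mul_of_nonneg_left (add_le_add_right
      (mul_le_mul_of_nonneg_left hsum zero_le_two) _) (by positivity)).trans (le_of_eq ?_))
    rw [← hs2]
    field_simp
    ring
  have b1 : (N : ℝ) / H ≤ 2 * w ^ 4 := by
    rw [div_le_iff₀ hH0, hNq]
    linarith [mul_le_mul_of_nonneg_left hH1 (pow_pos hw0 4).le]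
  have b2 : s / q ≤ 0.764 := by rwa [div_le_iff₀ hq0]
  have b3 : H / q ^ 4 ≤ 0.0487 := by
    rw [div_le_iff₀ (by positivity)]
    linarith [mul_le_mul_of_nonneg_right hq12 (pow_pos hq0 2).le]
  have b4 : 48 * q ^ 3 / s ≤ 67.9 * q ^ 2 := by
    rw [div_le_iff₀ hs0]
    linarith [mul_le_mul_of_nonneg_left hs_lo (pow_pos hq0 2).le, mul_pos (pow_pos hq0 2) hs0]
  have b5 : (N : ℝ) + H ≤ 1.004 * N := by
    rw [hNq]
    linarith [mul_le_mul_of_nonneg_left hw4 (pow_pos hq0 2).le]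
  have key3 : S ^ 2 ≤ N * (11.35 * w ^ 4 + 68.2 * q ^ 2) := by
    have c1 : (N : ℝ) / H + 12 * w ^ 4 * (s / q) + 2 * (H / q ^ 4) * w ^ 4 + 4
      + 48 * q ^ 3 / s ≤ 11.3 * w ^ 4 + 67.9 * q ^ 2 := by
      linarith [mul_le_mul_of_nonneg_right b2 (pow_pos hw0 4).le,
        mul_le_mul_of_nonneg_right b3 (pow_pos hw0 4).le]
    refine key2.trans ((mul_le_mul b5 c1 (by positivity) (by positivity)).trans ?_)
    linarith [mul_pos hN0 (pow_pos hw0 4), mul_pos hN0 (pow_pos hq0 2)]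
  rw [hsN]
  apply (sq_le_sq₀ (by positivity) (by positivity)).1
  refine key3.trans ?_
  rw [hNq]
  have e : (q ^ 2 * w ^ 4 * (3.4 * w ^ 2 / (q * w ^ 2) + 8.3 / w ^ 2)) ^ 2 =
      q ^ 2 * w ^ 4 * (3.4 * w ^ 2 + 8.3 * q) ^ 2 := by
    field_simp
  rw [e]
  gcongr
  -- 3.4² > 11.35 and 8.3² > 68.2; the cross term is positive.
  nlinarith [mul_pos hq0 (pow_pos hw0 2)]

/-! ### From exponential sums to blocks of the Dirichlet series -/

lemma norm_sum_mul_le_of_antitone {a : ℕ → ℝ} {z : ℕ → ℂ} {N M : ℕ} {B : ℝ} (hNM : N < M)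
    (ha0 : ∀ n, 0 ≤ a n) (ha : ∀ n, N < n → a (n + 1) ≤ a n)
    (hB : ∀ m, N ≤ m → m ≤ M → ‖∑ n ∈ Finset.Ioc N m, z n‖ ≤ B) :
    ‖∑ n ∈ Finset.Ioc N M, (a n : ℂ) * z n‖ ≤ a (N + 1) * B := by
  have key : ∀ m, N + 1 ≤ m → m ≤ M →
      ‖∑ n ∈ Finset.Ioc N m, (a n : ℂ) * z n - a m * ∑ n ∈ Finset.Ioc N m, z n‖ ≤
        (a (N + 1) - a m) * B := by
    intro m hm
    induction m, hm using Nat.le_induction with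
    | base => intro _; simp
    | succ m hm ih =>
      intro hmM
      rw [Finset.sum_Ioc_succ_top (by omega), Finset.sum_Ioc_succ_top (by omega)]
      have e : ∑ n ∈ Finset.Ioc N m, (a n : ℂ) * z n + (a (m + 1) : ℂ) * z (m + 1) -
          a (m + 1) * (∑ n ∈ Finset.Ioc N m, z n + z (m + 1)) =
          (∑ n ∈ Finset.Ioc N m, (a n : ℂ) * z n - a m * ∑ n ∈ Finset.Ioc N m, z n) +
          ((a m - a (m + 1) : ℝ) : ℂ) * ∑ n ∈ Finset.Ioc N m, z n := by
        push_cast; ring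
      rw [e]
      refine (norm_add_le _ _).trans ?_
      have hd : 0 ≤ a m - a (m + 1) := sub_nonneg.2 (ha m (by omega))
      rw [norm_mul, Complex.norm_real, Real.norm_eq_abs, abs_of_nonneg hd]
      have h1 := mul_le_mul_of_nonneg_left (hB m (by omega) (by omega)) hd
      have h2 := ih (by omega)
      linarith
  have h1 := key M (by omega) le_rfl
  have h2 := mul_le_mul_of_nonneg_left (hB M hNM.le le_rfl) (ha0 M)
  have e : ∑ n ∈ Finset.Ioc N M, (a n : ℂ) * z n =
      (∑ n ∈ Finset.Ioc N M, (a n : ℂ) * z n - a M * ∑ n ∈ Finset.Ioc N M, z n) +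
        a M * ∑ n ∈ Finset.Ioc N M, z n := by ring
  rw [e]
  refine (norm_add_le _ _).trans ?_
  rw [norm_mul, Complex.norm_real, Real.norm_eq_abs, abs_of_nonneg (ha0 M)]
  linarith

lemma one_div_natCast_cpow {n : ℕ} (hn : 1 ≤ n) (σ τ : ℝ) :
    1 / (n : ℂ) ^ ((σ : ℂ) + ((2 * Real.pi * τ : ℝ) : ℂ) * Complex.I) =
      (((n : ℝ) ^ (-σ) : ℝ) : ℂ) * unitPhase (-τ * Real.log n) := by
  have hn0 : (0 : ℝ) < n := by exact_mod_cast hn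
  rw [Real.rpow_def_of_pos hn0, unitPhase, Complex.cpow_def_of_ne_zero (by exact_mod_cast hn0.ne'),
    one_div, ← Complex.exp_neg, Complex.ofReal_exp, ← Complex.exp_add, ← Complex.natCast_log]
  congr 1
  push_cast
  ring

/-- Passing from exponential sums to blocks of the Dirichlet series. -/
lemma norm_dirichlet_block_le {σ τ B : ℝ} (hσ : 1 ≤ σ) {N M : ℕ} (hN : 1 ≤ N) (hNM : N < M)
    (hB : ∀ m, N ≤ m → m ≤ M → ‖∑ n ∈ Finset.Ioc N m, unitPhase (-τ * Real.log n)‖ ≤ N * B) :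
    ‖∑ n ∈ Finset.Ioc N M,
      1 / (n : ℂ) ^ ((σ : ℂ) + ((2 * Real.pi * τ : ℝ) : ℂ) * Complex.I)‖ ≤ B := by
  have hN0 : (0 : ℝ) < N := by exact_mod_cast hN
  rw [Finset.sum_congr rfl fun n hn => one_div_natCast_cpow (by
    rw [Finset.mem_Ioc] at hn; omega) σ τ]
  have hB0 : 0 ≤ N * B := (norm_nonneg _).trans (hB N le_rfl hNM.le)
  refine (norm_sum_mul_le_of_antitone hNM (fun n => by positivity) (fun n hn => ?_) hB).trans ?_
  · apply Real.rpow_le_rpow_of_nonpos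
    · have : 0 < n := by omega
      exact_mod_cast this
    · push_cast; linarith
    · linarith
  -- The leading weight cancels the factor N in the hypothesis on the exponential sums.
  · have h1 : (((N + 1 : ℕ) : ℝ)) ^ (-σ) ≤ 1 / N := by
      refine (Real.rpow_le_rpow_of_exponent_le (y := -σ) (z := -1) (by push_cast; linarith)
        (by linarith)).trans ?_
      rw [Real.rpow_neg_one, ← one_div]
      apply one_div_le_one_div_of_le hN0
      push_cast; linarith
    refine (mul_le_mul_of_nonneg_right h1 hB0).trans (le_of_eq ?_)
    field_simp

/-- A geometric series of ratio 1/√2, with 1/(1 - 1/√2) < 3.415; the constant C is paid once per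
block. -/
lemma norm_dyadic_sum_le (f : ℕ → ℂ) (N : ℕ) {A C : ℝ} (hA : 0 ≤ A) (k : ℕ)
    (h : ∀ j < k, ‖∑ n ∈ Finset.Ioc (2 ^ j * N) (2 * (2 ^ j * N)), f n‖ ≤ A / √2 ^ j + C) :
    ‖∑ n ∈ Finset.Ioc N (2 ^ k * N), f n‖ ≤ 3.415 * A + k * C := by
  have h2 : 1 / √2 ≤ 0.7071068 := by
    rw [div_le_iff₀ (by positivity)]
    have : (1.41421356 : ℝ) ≤ √2 := Real.le_sqrt_of_sq_le (by norm_num)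
    linarith
  have key : ∀ j ≤ k, ‖∑ n ∈ Finset.Ioc N (2 ^ j * N), f n‖ ≤
      3.415 * A * (1 - 1 / √2 ^ j) + j * C := by
    intro j
    induction j with
    | zero => intro _; simp
    | succ j ih =>
      intro hj
      have e : 2 ^ (j + 1) * N = 2 * (2 ^ j * N) := by ring
      rw [e, ← Finset.sum_Ioc_consecutive _ (Nat.le_mul_of_pos_left N (by positivity))
        (Nat.le_mul_of_pos_left _ two_pos)]
      refine (norm_add_le _ _).trans ((add_le_add (ih (by omega)) (h j (by omega))).trans ?_)
      have hp : 0 ≤ A * (1 / √2 ^ j) := by positivity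
      have e2 : 1 / √2 ^ (j + 1) = 1 / √2 ^ j * (1 / √2) := by
        rw [pow_succ]; field_simp
      rw [e2]
      push_cast
      have := mul_le_mul_of_nonneg_left h2 hp
      rw [div_eq_mul_one_div A]
      linarith
  refine (key k le_rfl).trans ?_
  have : 0 ≤ 3.415 * A * (1 / √2 ^ k) := by positivity
  linarith

lemma log_le_of_exp_one {w : ℝ} (hw : 0 < w) : Real.log w ≤ 0.36789 * w := by
  have h := Real.log_le_sub_one_of_pos (show 0 < w / Real.exp 1 by positivity)
  rw [Real.log_div hw.ne' (Real.exp_pos _).ne', Real.log_exp] at h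
  have h1 := Real.exp_one_gt_d9
  have h2 : w / Real.exp 1 ≤ 0.36789 * w := by
    rw [div_le_iff₀ (Real.exp_pos _)]
    nlinarith
  linarith

/-- The number of doublings needed to get from `N` to `X`. -/
lemma exists_doublings {N m : ℕ} {w X : ℝ} (hw : 0 < w) (hN : 1 ≤ N)
    (hX : X ≤ 1.001 * w ^ m * N) :
    ∃ k : ℕ, X ≤ (2 ^ k * N : ℕ) ∧ (k : ℝ) ≤ 1.002 + 0.531 * m * w := by
  have hN0 : (0 : ℝ) < N := by exact_mod_cast hN
  have hex : ∃ k : ℕ, X ≤ (2 ^ k * N : ℕ) := by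
    obtain ⟨k, hk⟩ := pow_unbounded_of_one_lt (X / N) (one_lt_two (α := ℝ))
    refine ⟨k, ?_⟩
    push_cast
    rw [div_lt_iff₀ hN0] at hk
    exact hk.le
  classical
  refine ⟨Nat.find hex, Nat.find_spec hex, ?_⟩
  rcases hk : Nat.find hex with _ | k
  · simp; positivity
  -- Minimality: one doubling fewer falls short of X. Then 0.531 exceeds 0.36789/log 2, and 1.002
  -- absorbs the last doubling and log 1.001.
  · have h1 : ¬ X ≤ (2 ^ k * N : ℕ) := Nat.find_min hex (by omega)
    push_cast at h1
    have h2 : (2 : ℝ) ^ k < 1.001 * w ^ m := by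
      refine lt_of_mul_lt_mul_right ?_ hN0.le
      linarith
    have h3 := Real.log_le_log (by positivity) h2.le
    rw [Real.log_mul (by norm_num) (by positivity), Real.log_pow, Real.log_pow] at h3
    have h4 := Real.log_le_sub_one_of_pos (show (0 : ℝ) < 1.001 by norm_num)
    have h5 := Real.log_two_gt_d9
    have h6 := mul_le_mul_of_nonneg_left (log_le_of_exp_one hw) (Nat.cast_nonneg (α := ℝ) m)
    have h7 : (0 : ℝ) ≤ m * w := by positivity
    have h8 : (0 : ℝ) ≤ k := by positivity
    push_cast
    nlinarith

/-! ### Approximation of ζ by long partial sums -/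

/-- The bracket is the integral of x^(-s) over [m, m+1]. The mean value inequality is used twice:
for the oscillation of x^(-s), whose derivative is at most |s|/m², then for the primitive minus a
linear function. -/
lemma norm_natCast_cpow_sub_integral_le {s : ℂ} (hs : 1 < s.re) {m : ℕ} (hm : 1 ≤ m) :
    ‖(((m + 1 : ℕ) : ℂ) ^ (1 - s) / (1 - s) - (m : ℂ) ^ (1 - s) / (1 - s))
      - 1 / ((m + 1 : ℕ) : ℂ) ^ s‖ ≤ ‖s‖ / (m : ℝ) ^ 2 := by
  have hm0 : (0 : ℝ) < m := by exact_mod_cast hm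
  have hs0 : s ≠ 0 := by rintro rfl; norm_num at hs
  have hs1 : s ≠ 1 := by rintro rfl; norm_num at hs
  set I := Set.Icc (m : ℝ) (m + 1) with hI
  have hIc : Convex ℝ I := convex_Icc _ _
  have hv : ∀ x ∈ I, ∀ y ∈ I, ‖(x : ℂ) ^ (-s) - (y : ℂ) ^ (-s)‖ ≤ ‖s‖ / (m : ℝ) ^ 2 := by
    intro x hx y hy
    have hd : ∀ x ∈ I, HasDerivWithinAt (fun x : ℝ => (x : ℂ) ^ (-s))
        (-s * (x : ℂ) ^ (-s - 1)) I x := by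
      intro x hx
      have hx0 : x ≠ 0 := (hm0.trans_le hx.1).ne'
      exact (hasDerivAt_ofReal_cpow_const hx0 (neg_ne_zero.2 hs0)).hasDerivWithinAt
    have hb : ∀ x ∈ I, ‖-s * (x : ℂ) ^ (-s - 1)‖ ≤ ‖s‖ / (m : ℝ) ^ 2 := by
      intro x hx
      have hx0 : 0 < x := hm0.trans_le hx.1
      have hx1 : 1 ≤ x := le_trans (by exact_mod_cast hm) hx.1
      rw [norm_mul, norm_neg, Complex.norm_cpow_eq_rpow_re_of_pos hx0, div_eq_mul_one_div]
      gcongr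
      refine (Real.rpow_le_rpow_of_exponent_le (z := -2) hx1 (by simp; linarith)).trans ?_
      rw [Real.rpow_neg hx0.le, ← one_div]
      norm_num
      gcongr
      exact hx.1
    refine (hIc.norm_image_sub_le_of_norm_hasDerivWithin_le hd hb hy hx).trans ?_
    have : ‖x - y‖ ≤ 1 := by
      rw [Real.norm_eq_abs, abs_le]
      constructor <;> linarith [hx.1, hx.2, hy.1, hy.2]
    exact mul_le_of_le_one_right (by positivity) this
  have hd : ∀ x ∈ I, HasDerivWithinAt (fun x : ℝ => (x : ℂ) ^ (1 - s) / (1 - s)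
      - (x : ℂ) * ((m + 1 : ℝ) : ℂ) ^ (-s))
      ((x : ℂ) ^ (-s) - ((m + 1 : ℝ) : ℂ) ^ (-s)) I x := by
    intro x hx
    have hx0 : x ≠ 0 := (hm0.trans_le hx.1).ne'
    have h0 : 1 - s ≠ 0 := sub_ne_zero.2 hs1.symm
    have h1 := (hasDerivAt_ofReal_cpow_const hx0 h0).div_const (1 - s)
    rw [mul_div_cancel_left₀ _ h0, show 1 - s - 1 = -s by ring] at h1
    have h2 := (Complex.ofRealCLM.hasDerivAt (x := x)).mul_const (((m + 1 : ℝ) : ℂ) ^ (-s))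
    have h3 := h1.sub h2
    simp only [Complex.ofRealCLM_apply, Complex.ofReal_one, one_mul] at h3
    exact h3.hasDerivWithinAt
  have hmem : (m : ℝ) ∈ I := ⟨le_rfl, by linarith⟩
  have hmem' : (m : ℝ) + 1 ∈ I := ⟨by linarith, le_rfl⟩
  have := hIc.norm_image_sub_le_of_norm_hasDerivWithin_le hd
    (fun x hx => hv x hx _ hmem') hmem hmem'
  rw [add_sub_cancel_left, norm_one, mul_one] at this
  refine le_trans (le_of_eq ?_) this
  congr 1
  rw [one_div, ← Complex.cpow_neg]
  push_cast
  ring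

lemma sum_inv_sq_le {N M : ℕ} (hN : 2 ≤ N) (hNM : N ≤ M) :
    ∑ m ∈ Finset.Ico N M, 1 / (m : ℝ) ^ 2 ≤ 1 / ((N : ℝ) - 1) - 1 / ((M : ℝ) - 1) := by
  induction M, hNM using Nat.le_induction with
  | base => simp
  | succ M hM ih =>
    rw [Finset.sum_Ico_succ_top hM]
    have : (2 : ℝ) ≤ M := by exact_mod_cast hN.trans hM
    have h : 1 / (M : ℝ) ^ 2 ≤ 1 / ((M : ℝ) - 1) - 1 / (((M + 1 : ℕ) : ℝ) - 1) := by
      push_cast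
      rw [add_sub_cancel_right, div_sub_div _ _ (by linarith) (by linarith),
        div_le_div_iff₀ (by positivity) (by nlinarith)]
      nlinarith
    linarith

/-- The tail of the Dirichlet series of `ζ`, bounded uniformly in the upper end point. -/
lemma norm_sum_Ico_dirichlet_le {σ t : ℝ} (hσ : 1 < σ) (ht : 0 < t) {N M : ℕ} (hN : 2 ≤ N)
    (hNM : N ≤ M) :
    ‖∑ m ∈ Finset.Ico N M, 1 / ((m + 1 : ℕ) : ℂ) ^ ((σ : ℂ) + (t : ℂ) * Complex.I)‖ ≤
      2 / t + (σ + t) / ((N : ℝ) - 1) := by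
  set s := (σ : ℂ) + (t : ℂ) * Complex.I with hs
  have hre : s.re = σ := by simp [hs]
  have him : s.im = t := by simp [hs]
  have hns : ‖s‖ ≤ σ + t := by
    refine (Complex.norm_le_abs_re_add_abs_im s).trans ?_
    rw [hre, him, abs_of_pos ht, abs_of_pos (by linarith)]
  -- Bounding |1 - s| below by t rather than σ - 1 keeps the estimate uniform as σ → 1.
  have hF : ∀ n : ℕ, 1 ≤ n → ‖(n : ℂ) ^ (1 - s) / (1 - s)‖ ≤ 1 / t := by
    intro n hn
    have hn0 : (0 : ℝ) < n := by exact_mod_cast hn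
    rw [norm_div]
    have h1 : t ≤ ‖1 - s‖ := by
      have := Complex.abs_im_le_norm (1 - s)
      rw [Complex.sub_im, him, Complex.one_im, zero_sub, abs_neg, abs_of_pos ht] at this
      exact this
    have h2 : ‖(n : ℂ) ^ (1 - s)‖ ≤ 1 := by
      rw [← Complex.ofReal_natCast, Complex.norm_cpow_eq_rpow_re_of_pos hn0]
      apply Real.rpow_le_one_of_one_le_of_nonpos (by exact_mod_cast hn)
      rw [Complex.sub_re, hre, Complex.one_re]
      linarith
    exact div_le_div₀ zero_le_one h2 ht h1
  have htel := Finset.sum_Ico_sub (fun n : ℕ => (n : ℂ) ^ (1 - s) / (1 - s)) hNM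
  have e : ∑ m ∈ Finset.Ico N M, 1 / ((m + 1 : ℕ) : ℂ) ^ s =
      ((M : ℂ) ^ (1 - s) / (1 - s) - (N : ℂ) ^ (1 - s) / (1 - s)) -
      ∑ m ∈ Finset.Ico N M, ((((m + 1 : ℕ) : ℂ) ^ (1 - s) / (1 - s) - (m : ℂ) ^ (1 - s) / (1 - s))
      - 1 / ((m + 1 : ℕ) : ℂ) ^ s) := by
    rw [Finset.sum_sub_distrib, htel]
    ring
  have hsum : ‖∑ m ∈ Finset.Ico N M, ((((m + 1 : ℕ) : ℂ) ^ (1 - s) / (1 - s)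
      - (m : ℂ) ^ (1 - s) / (1 - s)) - 1 / ((m + 1 : ℕ) : ℂ) ^ s)‖ ≤
      (σ + t) / ((N : ℝ) - 1) := by
    refine (norm_sum_le _ _).trans ((Finset.sum_le_sum fun m hm =>
      norm_natCast_cpow_sub_integral_le (by rwa [hre]) (by
        rw [Finset.mem_Ico] at hm; omega)).trans ?_)
    have h2 : (2 : ℝ) ≤ N := by exact_mod_cast hN
    have h3 : (N : ℝ) ≤ M := by exact_mod_cast hNM
    have h1 := sum_inv_sq_le hN hNM
    have h4 : 0 ≤ 1 / ((M : ℝ) - 1) := by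
      apply div_nonneg zero_le_one; linarith
    have h5 : ∑ m ∈ Finset.Ico N M, ‖s‖ / (m : ℝ) ^ 2 =
        ‖s‖ * ∑ m ∈ Finset.Ico N M, 1 / (m : ℝ) ^ 2 := by
      rw [Finset.mul_sum]
      exact Finset.sum_congr rfl fun m _ => by ring
    rw [h5, div_eq_mul_one_div (σ + t)]
    exact mul_le_mul hns (by linarith) (Finset.sum_nonneg fun m _ => by positivity) (by linarith)
  rw [e]
  refine (norm_sub_le _ _).trans (add_le_add ((norm_sub_le _ _).trans ?_) hsum)
  have a := hF M (by omega)
  have b := hF N (by omega)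
  have : 2 / t = 1 / t + 1 / t := by ring
  linarith

/-- Approximation of `ζ` by partial sums of its Dirichlet series. -/
theorem norm_zeta_sub_sum_le {σ t : ℝ} (hσ : 1 < σ) (ht : 0 < t) {N : ℕ} (hN : 2 ≤ N) :
    ‖riemannZeta ((σ : ℂ) + (t : ℂ) * Complex.I) -
      ∑ n ∈ Finset.Icc 1 N, 1 / (n : ℂ) ^ ((σ : ℂ) + (t : ℂ) * Complex.I)‖ ≤
      2 / t + (σ + t) / ((N : ℝ) - 1) := by
  set s := (σ : ℂ) + (t : ℂ) * Complex.I with hs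
  have hre : 1 < s.re := by simp [hs, hσ]
  have hsum : Summable fun n : ℕ => 1 / ((n + 1 : ℕ) : ℂ) ^ s :=
    (summable_nat_add_iff 1).2 (Complex.summable_one_div_nat_cpow.2 hre)
  have hlim := hsum.hasSum.tendsto_sum_nat
  have hz : riemannZeta s = ∑' n : ℕ, 1 / ((n + 1 : ℕ) : ℂ) ^ s := by
    rw [zeta_eq_tsum_one_div_nat_add_one_cpow hre]
    push_cast
    rfl
  rw [← hz] at hlim
  have hset : ∑ n ∈ Finset.Icc 1 N, 1 / (n : ℂ) ^ s =
      ∑ m ∈ Finset.range N, 1 / ((m + 1 : ℕ) : ℂ) ^ s := by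
    rw [Finset.range_eq_Ico, Finset.sum_Ico_add' (fun n : ℕ => 1 / (n : ℂ) ^ s)]
    rfl
  rw [hset]
  refine le_of_tendsto (hlim.sub_const _).norm ?_
  filter_upwards [Filter.eventually_ge_atTop N] with M hM
  rw [← Finset.sum_range_add_sum_Ico _ hM, add_sub_cancel_left]
  exact norm_sum_Ico_dirichlet_le hσ ht hN hM

/-! ### Small τ: the trivial estimate -/

lemma norm_one_div_cpow_le {σ t : ℝ} (hσ : 1 ≤ σ) {n : ℕ} (hn : 1 ≤ n) :
    ‖1 / (n : ℂ) ^ ((σ : ℂ) + (t : ℂ) * Complex.I)‖ ≤ 1 / n := by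
  have hn0 : (0 : ℝ) < n := by exact_mod_cast hn
  rw [norm_div, norm_one, ← Complex.ofReal_natCast, Complex.norm_cpow_eq_rpow_re_of_pos hn0]
  apply one_div_le_one_div_of_le hn0
  simpa using Real.rpow_le_rpow_of_exponent_le (y := 1) (z := σ) (by exact_mod_cast hn) hσ

lemma sum_Ioc_inv_le_log {N M : ℕ} (hN : 1 ≤ N) (hNM : N ≤ M) :
    ∑ n ∈ Finset.Ioc N M, 1 / (n : ℝ) ≤ Real.log M - Real.log N := by
  induction M, hNM using Nat.le_induction with
  | base => simp
  | succ M hM ih =>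
    rw [Finset.sum_Ioc_succ_top (by omega)]
    have hM0 : (0 : ℝ) < M := by exact_mod_cast hN.trans hM
    have h := log_sub_log_le (x := M) (y := (M + 1 : ℕ)) hM0 (by positivity)
    have e : (M : ℝ) / (M + 1 : ℕ) - 1 = -(1 / ((M + 1 : ℕ) : ℝ)) := by
      push_cast; field_simp; ring
    linarith

lemma sum_Icc_one_add_sum_Ioc (f : ℕ → ℂ) {N M : ℕ} (h : N ≤ M) :
    ∑ n ∈ Finset.Icc 1 M, f n = ∑ n ∈ Finset.Icc 1 N, f n + ∑ n ∈ Finset.Ioc N M, f n := by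
  have e : ∀ k, Finset.Icc 1 k = Finset.Ioc 0 k := fun k => by
    ext; simp only [Finset.mem_Ioc, Finset.mem_Icc]; omega
  rw [e, e, Finset.sum_Ioc_consecutive _ (Nat.zero_le _) h]

/-- Here 39.2/w ≥ 11.2, while the terms up to N ≈ t contribute at most 10 and the tail at most 1.1.
-/
lemma norm_zeta_sub_sum_le_of_small {σ w : ℝ} (hσ : 1 < σ) (hσ' : σ ≤ 3 / 2) (hw0 : 0 < w)
    (hw : w ≤ 7 / 2) (hτ : 20 < w ^ 12) :
    ‖riemannZeta ((σ : ℂ) + ((2 * Real.pi * w ^ 12 : ℝ) : ℂ) * Complex.I) -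
      ∑ n ∈ Finset.Icc 1 ⌊w ^ 6⌋₊,
        1 / (n : ℂ) ^ ((σ : ℂ) + ((2 * Real.pi * w ^ 12 : ℝ) : ℂ) * Complex.I)‖ ≤ 39.2 / w := by
  set t := 2 * Real.pi * w ^ 12 with ht
  set s := (σ : ℂ) + (t : ℂ) * Complex.I with hs
  have hpi := Real.pi_gt_d2
  have hpi' := Real.pi_lt_d2
  have ht1 : 125 < t := by rw [ht]; nlinarith
  have ht2 : t ≤ 6.3 * w ^ 12 := by rw [ht]; nlinarith
  have hw6 : 4 ≤ w ^ 6 := by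
    apply (sq_le_sq₀ (by norm_num) (by positivity)).1
    rw [← pow_mul]; norm_num; linarith
  obtain ⟨N₀, hN₀⟩ : ∃ N, N = ⌊w ^ 6⌋₊ := ⟨_, rfl⟩
  obtain ⟨N, hN⟩ : ∃ N, N = ⌈t⌉₊ + 1 := ⟨_, rfl⟩
  rw [← hN₀]
  have h4 : 4 ≤ N₀ := by rw [hN₀]; exact Nat.le_floor (by exact_mod_cast hw6)
  have h4' : (4 : ℝ) ≤ N₀ := by exact_mod_cast h4
  have h5 : w ^ 6 ≤ 1.25 * N₀ := by
    have := Nat.lt_floor_add_one (w ^ 6)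
    rw [← hN₀] at this
    linarith
  have h5' : (N₀ : ℝ) ≤ w ^ 6 := by rw [hN₀]; exact Nat.floor_le (by positivity)
  have hN1 : t ≤ (N : ℝ) - 1 := by
    rw [hN]; push_cast; linarith [Nat.le_ceil t]
  have hN2 : (N : ℝ) ≤ 6.4 * w ^ 12 := by
    have := Nat.ceil_lt_add_one (show 0 ≤ t by linarith)
    rw [hN]; push_cast; linarith
  have hNN : N₀ ≤ N := by
    have : (N₀ : ℝ) ≤ N := by
      have : w ^ 6 * 4 ≤ w ^ 6 * w ^ 6 := by gcongr
      have e : w ^ 6 * w ^ 6 = w ^ 12 := by ring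
      have : 6 * w ^ 12 ≤ t := by rw [ht]; nlinarith
      linarith
    exact_mod_cast this
  have hlog : Real.log N - Real.log N₀ ≤ 10 := by
    have hNpos : (0 : ℝ) < N := by linarith
    rw [← Real.log_div hNpos.ne' (by linarith), Real.log_le_iff_le_exp (by positivity)]
    have h6 : (N : ℝ) / N₀ ≤ 8 * w ^ 6 := by
      rw [div_le_iff₀ (by linarith)]
      have : w ^ 6 * w ^ 6 ≤ w ^ 6 * (1.25 * N₀) := by gcongr
      have e : w ^ 6 * w ^ 6 = w ^ 12 := by ring
      linarith
    -- 8·(7/2)^6 is below 2.7^10, hence below e^10.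
    have h7 : w ^ 6 ≤ (7 / 2) ^ 6 := by gcongr
    have h8 : (2.7 : ℝ) ^ 10 ≤ Real.exp 1 ^ 10 := by
      have := Real.exp_one_gt_d9
      gcongr
      linarith
    rw [← Real.exp_nat_mul] at h8
    norm_num at h7 h8 ⊢
    linarith
  have hA := norm_zeta_sub_sum_le hσ (show 0 < t by linarith) (N := N) (by omega)
  rw [sum_Icc_one_add_sum_Ioc _ hNN] at hA
  have hB : ‖∑ n ∈ Finset.Ioc N₀ N, 1 / (n : ℂ) ^ s‖ ≤ 10 := by
    refine (norm_sum_le _ _).trans ((Finset.sum_le_sum fun n hn =>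
      norm_one_div_cpow_le hσ.le (by rw [Finset.mem_Ioc] at hn; omega)).trans
        ((sum_Ioc_inv_le_log (by omega) hNN).trans hlog))
  have hC : 2 / t + (σ + t) / ((N : ℝ) - 1) ≤ 1.1 := by
    have h6 : (σ + t) / ((N : ℝ) - 1) ≤ (σ + t) / t := by gcongr
    have h7 : 2 / t + (σ + t) / t = 1 + (2 + σ) / t := by field_simp; ring
    have h8 : (2 + σ) / t ≤ 0.1 := by
      rw [div_le_iff₀ (by linarith)]; linarith
    linarith
  have hD : (11.2 : ℝ) ≤ 39.2 / w := by
    rw [le_div_iff₀ hw0]; linarith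
  rw [← hs] at hA
  have e : ∀ z a b : ℂ, z - a = (z - (a + b)) + b := fun z a b => by ring
  rw [e _ _ (∑ n ∈ Finset.Ioc N₀ N, 1 / (n : ℂ) ^ s)]
  refine (norm_add_le _ _).trans ?_
  linarith

/-! ### Large τ: the two ranges, the tail and their total -/

lemma norm_dirichlet_first_range_le {σ w : ℝ} (hσ : 1 ≤ σ) (hw : 7 / 2 ≤ w) {N : ℕ}
    (hN1 : 1 ≤ N) (hN2 : w ^ 6 ≤ 1.001 * N) (hN4 : 12 * w ^ 4 ≤ N) (k : ℕ) :
    ‖∑ n ∈ Finset.Ioc N (2 ^ k * N),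
      1 / (n : ℂ) ^ ((σ : ℂ) + ((2 * Real.pi * w ^ 12 : ℝ) : ℂ) * Complex.I)‖ ≤
      3.415 * (3.402 / w) + k * (8.3 / w ^ 2) := by
  have hw0 : 0 < w := by linarith
  refine norm_dyadic_sum_le _ N (by positivity) k fun j _ => ?_
  have h1 : N ≤ 2 ^ j * N := Nat.le_mul_of_pos_left _ (by positivity)
  refine norm_dirichlet_block_le hσ (by omega) (by omega) fun m hm hm' => ?_
  refine (norm_sum_log_le_third hw (hN4.trans (by exact_mod_cast h1)) hm hm').trans ?_
  refine mul_le_mul_of_nonneg_left (add_le_add ?_ le_rfl) (Nat.cast_nonneg _)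
  push_cast
  have e : √((2 : ℝ) ^ j * N) = √2 ^ j * √N := by
    rw [Real.sqrt_mul (by positivity)]
    congr 1
    rw [Real.sqrt_eq_iff_mul_self_eq (by positivity) (by positivity), ← mul_pow,
      Real.mul_self_sqrt zero_le_two]
  have h2 : w ^ 3 ≤ 1.0005 * √N := by
    apply (sq_le_sq₀ (by positivity) (by positivity)).1
    rw [mul_pow, Real.sq_sqrt (by positivity)]
    linarith
  have hs0 : 0 < √(N : ℝ) := Real.sqrt_pos.2 (by exact_mod_cast hN1)
  have h2j : (0 : ℝ) < √2 ^ j := by positivity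
  rw [e, div_div, div_le_div_iff₀ (by positivity) (by positivity)]
  have := mul_le_mul_of_nonneg_left h2 h2j.le
  have h3 : 0 < √2 ^ j * √(N : ℝ) := by positivity
  linarith

lemma norm_dirichlet_second_range_le {σ w : ℝ} (hσ : 1 ≤ σ) (hw : 7 / 2 ≤ w) {N : ℕ}
    (hN1 : 1 ≤ N) (hN : w ^ 8 ≤ N) (k : ℕ) :
    ‖∑ n ∈ Finset.Ioc N (2 ^ k * N),
      1 / (n : ℂ) ^ ((σ : ℂ) + ((2 * Real.pi * w ^ 12 : ℝ) : ℂ) * Complex.I)‖ ≤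
      3.415 * (6.1 / w ^ 2) + k * (12.2 / w ^ 6) := by
  have hw0 : 0 < w := by linarith
  have hw2 : 12.25 ≤ w ^ 2 := by nlinarith
  -- The decay available is 2^(-j); only the rate required by `norm_dyadic_sum_le` is kept.
  have hsq2 : ∀ j : ℕ, √2 ^ j ≤ (2 : ℝ) ^ j := fun j => by
    gcongr
    exact Real.sqrt_le_iff.2 ⟨by norm_num, by norm_num⟩
  refine norm_dyadic_sum_le _ N (by positivity) k fun j _ => ?_
  have h1 : N ≤ 2 ^ j * N := Nat.le_mul_of_pos_left _ (by positivity)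
  refine norm_dirichlet_block_le hσ (by omega) (by omega) fun m hm hm' => ?_
  refine (norm_sum_log_le_second (τ := w ^ 12) (by positivity) (by omega) hm hm').trans ?_
  have hsw : √(w ^ 12) = w ^ 6 := by
    rw [show w ^ 12 = (w ^ 6) ^ 2 by ring, Real.sqrt_sq (by positivity)]
  have hX : w ^ 8 * √2 ^ j ≤ (2 ^ j * N : ℕ) := by
    push_cast
    rw [mul_comm]
    exact mul_le_mul (hsq2 j) hN (by positivity) (by positivity)
  have hX' : w ^ 8 ≤ (2 ^ j * N : ℕ) := hN.trans (by exact_mod_cast h1)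
  rw [hsw]
  generalize ((2 ^ j * N : ℕ) : ℝ) = X at *
  have hX0 : 0 < X := lt_of_lt_of_le (by positivity) hX'
  have h2j : (0 : ℝ) < √2 ^ j := by positivity
  have e1 : (w ^ 12 / X + 2) * (6 * X / w ^ 6 + 1) =
      X * (6 * (w ^ 6 / X) + 12 / w ^ 6 + w ^ 12 / X / X + 2 / X) := by
    field_simp
    ring
  rw [e1]
  refine mul_le_mul_of_nonneg_left ?_ hX0.le
  have a1 : w ^ 6 / X ≤ 1 / w ^ 2 / √2 ^ j := by
    rw [div_div, div_le_div_iff₀ hX0 (by positivity)]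
    linarith
  have a2 : w ^ 12 / X / X ≤ 0.1 * (1 / w ^ 2 / √2 ^ j) := by
    refine le_trans ?_ (mul_le_mul_of_nonneg_left a1 (by norm_num))
    rw [div_div, ← mul_div_assoc, div_le_div_iff₀ (by positivity) hX0]
    have : w ^ 6 ≤ 0.1 * X := by
      linarith [mul_le_mul_of_nonneg_right hw2 (pow_pos hw0 6).le, pow_pos hw0 6]
    have := mul_le_mul_of_nonneg_left this (show 0 ≤ w ^ 6 * X by positivity)
    linarith
  have a3 : 2 / X ≤ 0.2 / w ^ 6 := by
    rw [div_le_div_iff₀ hX0 (by positivity)]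
    linarith [mul_le_mul_of_nonneg_right hw2 (pow_pos hw0 6).le, pow_pos hw0 6]
  have e2 : 6.1 / w ^ 2 / √2 ^ j + 12.2 / w ^ 6 =
      6.1 * (1 / w ^ 2 / √2 ^ j) + 12 / w ^ 6 + 0.2 / w ^ 6 := by ring
  rw [e2]
  linarith

lemma tail_bound_le {σ w X : ℝ} (hσ : σ ≤ 3 / 2) (hw : 7 / 2 ≤ w)
    (hX : w ^ 14 ≤ X) :
    2 / (2 * Real.pi * w ^ 12) + (σ + 2 * Real.pi * w ^ 12) / (X - 1) ≤ 6.5 / w ^ 2 := by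
  have hw0 : 0 < w := by linarith
  have hpi := Real.pi_gt_d2
  have hpi' := Real.pi_lt_d4
  have hw10 : 1000 ≤ w ^ 10 := by
    have : (7 / 2 : ℝ) ^ 10 ≤ w ^ 10 := by gcongr
    norm_num at this
    linarith
  have hw2 : 12.25 ≤ w ^ 2 := by nlinarith
  have h12 : 1000 * w ^ 2 ≤ w ^ 12 := by
    linarith [mul_le_mul_of_nonneg_right hw10 (pow_pos hw0 2).le]
  have h14 : 1000 ≤ w ^ 14 := by nlinarith [mul_le_mul h12 hw2 (by norm_num) (by positivity)]
  have h1 : 2 / (2 * Real.pi * w ^ 12) ≤ 0.1 / w ^ 2 := by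
    rw [div_le_div_iff₀ (by positivity) (by positivity)]
    have := mul_le_mul_of_nonneg_right hpi.le (pow_pos hw0 12).le
    linarith
  have h2 : (σ + 2 * Real.pi * w ^ 12) / (X - 1) ≤ 6.4 / w ^ 2 := by
    rw [div_le_div_iff₀ (by linarith) (by positivity)]
    have h3 : σ + 2 * Real.pi * w ^ 12 ≤ 6.3 * w ^ 12 := by
      have := mul_le_mul_of_nonneg_right hpi'.le (pow_pos hw0 12).le
      linarith
    have h4 := mul_le_mul_of_nonneg_right h3 (pow_pos hw0 2).le
    linarith
  have : 6.5 / w ^ 2 = 0.1 / w ^ 2 + 6.4 / w ^ 2 := by ring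
  linarith

/-- Since log w was bounded linearly, k₁/w² is of order 1/w; k₂/w^6 is negligible, and w ≥ 7/2 turns
each 1/w² into 2/7 of 1/w. -/
lemma total_bound_le {w k₁ k₂ : ℝ} (hw : 7 / 2 ≤ w) (hk₁ : k₁ ≤ 1.002 + 0.531 * 2 * w)
    (hk₂ : k₂ ≤ 1.002 + 0.531 * 6 * w) :
    3.415 * (3.402 / w) + k₁ * (8.3 / w ^ 2)
      + (3.415 * (6.1 / w ^ 2) + k₂ * (12.2 / w ^ 6)) + 6.5 / w ^ 2 ≤ 39.2 / w := by
  have hw0 : 0 < w := by linarith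
  have c1 : k₁ * (8.3 / w ^ 2) ≤ (1.002 + 0.531 * 2 * w) * (8.3 / w ^ 2) := by gcongr
  have e1 : (1.002 + 0.531 * 2 * w) * (8.3 / w ^ 2) = 8.3166 * (1 / w ^ 2) + 8.8146 * (1 / w) := by
    field_simp
    ring
  have hk : k₂ ≤ 0.1 * w ^ 4 := by
    have h3 : (7 / 2 : ℝ) ^ 3 ≤ w ^ 3 := by gcongr
    norm_num at h3
    linarith [mul_le_mul_of_nonneg_right h3 hw0.le]
  have c2 : k₂ * (12.2 / w ^ 6) ≤ 1.22 * (1 / w ^ 2) := by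
    have e : 1.22 * (1 / w ^ 2) = 0.1 * w ^ 4 * (12.2 / w ^ 6) := by
      field_simp
      norm_num
    rw [e]
    gcongr
  have c3 : 1 / w ^ 2 ≤ 2 / 7 * (1 / w) := by
    rw [← mul_div_assoc, div_le_div_iff₀ (by positivity) hw0]
    nlinarith
  have c4 : 0 < 1 / w := by positivity
  rw [e1] at c1
  have d : ∀ a : ℝ, a / w ^ 2 = a * (1 / w ^ 2) := fun a => by ring
  have d' : ∀ a : ℝ, a / w = a * (1 / w) := fun a => by ring
  rw [d 6.1, d 6.5, d' 3.402, d' 39.2]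
  linarith

lemma norm_zeta_sub_sum_le_of_large {σ w : ℝ} (hσ : 1 < σ) (hσ' : σ ≤ 3 / 2)
    (hw : 7 / 2 ≤ w) :
    ‖riemannZeta ((σ : ℂ) + ((2 * Real.pi * w ^ 12 : ℝ) : ℂ) * Complex.I) -
      ∑ n ∈ Finset.Icc 1 ⌊w ^ 6⌋₊,
        1 / (n : ℂ) ^ ((σ : ℂ) + ((2 * Real.pi * w ^ 12 : ℝ) : ℂ) * Complex.I)‖ ≤ 39.2 / w := by
  have hw0 : 0 < w := by linarith
  have hw4 : 150 ≤ w ^ 4 := by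
    have : (7 / 2 : ℝ) ^ 4 ≤ w ^ 4 := by gcongr
    norm_num at this
    linarith
  have hw64 : 12.25 * w ^ 4 ≤ w ^ 6 := by
    have : 12.25 ≤ w ^ 2 := by nlinarith
    linarith [mul_le_mul_of_nonneg_right this (pow_pos hw0 4).le]
  obtain ⟨N₀, hN₀⟩ : ∃ N, N = ⌊w ^ 6⌋₊ := ⟨_, rfl⟩
  have hN₀1 : w ^ 6 - 1 ≤ N₀ := by
    have := Nat.lt_floor_add_one (w ^ 6)
    rw [← hN₀] at this
    linarith
  -- The floor loses at most 1, and w^6 ≥ 12.25·150 > 1800.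
  have hN₀2 : w ^ 6 ≤ 1.001 * N₀ := by linarith
  have hN₀3 : 1 ≤ N₀ := by
    have : (0 : ℝ) < N₀ := by linarith
    exact_mod_cast this
  have hN₀4 : 12 * w ^ 4 ≤ N₀ := by linarith
  obtain ⟨k₁, hk₁, hk₁'⟩ := exists_doublings (N := N₀) (m := 2) (X := w ^ 8) hw0 hN₀3 (by
    linarith [mul_le_mul_of_nonneg_left hN₀2 (pow_pos hw0 2).le])
  have hS₁ := norm_dirichlet_first_range_le hσ.le hw hN₀3 hN₀2 hN₀4 k₁
  obtain ⟨N₁, hN₁⟩ : ∃ N, N = 2 ^ k₁ * N₀ := ⟨_, rfl⟩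
  rw [← hN₁] at hk₁ hS₁
  have hN₁3 : 1 ≤ N₁ := by rw [hN₁]; exact Nat.mul_pos (by positivity) hN₀3
  obtain ⟨k₂, hk₂, hk₂'⟩ := exists_doublings (N := N₁) (m := 6) (X := w ^ 14) hw0 hN₁3 (by
    have := mul_le_mul_of_nonneg_left hk₁ (pow_pos hw0 6).le
    have h0 : 0 ≤ w ^ 6 * (N₁ : ℝ) := by positivity
    linarith)
  have hS₂ := norm_dirichlet_second_range_le hσ.le hw hN₁3 hk₁ k₂
  obtain ⟨N₂, hN₂⟩ : ∃ N, N = 2 ^ k₂ * N₁ := ⟨_, rfl⟩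
  rw [← hN₂] at hk₂ hS₂
  have hN₂2 : 2 ≤ N₂ := by
    have h14 : (7 / 2 : ℝ) ^ 14 ≤ w ^ 14 := by gcongr
    norm_num at h14
    have : (2 : ℝ) ≤ N₂ := by linarith
    exact_mod_cast this
  have hA := norm_zeta_sub_sum_le hσ (show 0 < 2 * Real.pi * w ^ 12 by positivity) hN₂2
  have hT := tail_bound_le hσ' hw hk₂
  have hfin := total_bound_le hw (by exact_mod_cast hk₁') (by exact_mod_cast hk₂')
  have hN₀₁ : N₀ ≤ N₁ := by rw [hN₁]; exact Nat.le_mul_of_pos_left _ (by positivity)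
  have hN₁₂ : N₁ ≤ N₂ := by rw [hN₂]; exact Nat.le_mul_of_pos_left _ (by positivity)
  rw [sum_Icc_one_add_sum_Ioc _ hN₁₂, sum_Icc_one_add_sum_Ioc _ hN₀₁] at hA
  rw [← hN₀]
  have e : ∀ z a b c : ℂ, z - a = (z - (a + b + c)) + b + c := fun z a b c => by ring
  rw [e _ _ (∑ n ∈ Finset.Ioc N₀ N₁, _) (∑ n ∈ Finset.Ioc N₁ N₂, _)]
  refine (norm_add_le _ _).trans ((add_le_add ((norm_add_le _ _).trans
    (add_le_add (hA.trans hT) hS₁)) hS₂).trans ?_)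
  linarith

/-! ### Assembly and the boundary case σ = 1 -/

theorem mainTheorem6 (σ t τ : ℝ) (hτ_def : τ = t / (2 * Real.pi))
    (hσ₁ : 1 ≤ σ) (hσ₂ : σ ≤ 3 / 2) (hτ : 20 < τ) :
    ‖riemannZeta ((σ : ℂ) + (t : ℂ) * Complex.I)
        - ∑ n ∈ Finset.Icc 1 ⌊τ ^ (1 / 2 : ℝ)⌋₊,
            1 / (n : ℂ) ^ ((σ : ℂ) + (t : ℂ) * Complex.I)‖
      ≤ 39.209 * τ ^ (-(1 / 12) : ℝ) + 24.447 * τ ^ (-(1 / 6) : ℝ)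
        + 30.400 * τ ^ (-(1 / 2) : ℝ) * Real.log τ + 15.804 * τ ^ (-(1 / 2) : ℝ)
        + 8 * τ ^ (-1 : ℝ) := by
  have hτ0 : 0 < τ := by linarith
  set w := τ ^ (1 / 12 : ℝ) with hw
  have hw0 : 0 < w := Real.rpow_pos_of_pos hτ0 _
  have hw12 : w ^ 12 = τ := by
    rw [hw, ← Real.rpow_natCast, ← Real.rpow_mul hτ0.le]; norm_num
  have hw6 : τ ^ (1 / 2 : ℝ) = w ^ 6 := by
    rw [hw, ← Real.rpow_natCast, ← Real.rpow_mul hτ0.le]; norm_num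
  have ht : t = 2 * Real.pi * w ^ 12 := by
    rw [hw12, hτ_def]; field_simp
  have hlog : 0 ≤ Real.log τ := Real.log_nonneg (by linarith)
  have hw1 : τ ^ (-(1 / 12) : ℝ) = 1 / w := by
    rw [Real.rpow_neg hτ0.le, ← hw, one_div]
  have hbound : 39.2 / w ≤ 39.209 * τ ^ (-(1 / 12) : ℝ) + 24.447 * τ ^ (-(1 / 6) : ℝ)
        + 30.400 * τ ^ (-(1 / 2) : ℝ) * Real.log τ + 15.804 * τ ^ (-(1 / 2) : ℝ)
        + 8 * τ ^ (-1 : ℝ) := by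
    have h1 : 0 ≤ 24.447 * τ ^ (-(1 / 6) : ℝ)
        + 30.400 * τ ^ (-(1 / 2) : ℝ) * Real.log τ + 15.804 * τ ^ (-(1 / 2) : ℝ)
        + 8 * τ ^ (-1 : ℝ) := by positivity
    have h2 : 39.2 / w ≤ 39.209 * (1 / w) := by
      rw [← mul_div_assoc, mul_one]; gcongr; norm_num
    rw [hw1]
    linarith
  refine le_trans ?_ hbound
  rw [hw6, ht]
  have hmain : ∀ σ : ℝ, 1 < σ → σ ≤ 3 / 2 →
      ‖riemannZeta ((σ : ℂ) + ((2 * Real.pi * w ^ 12 : ℝ) : ℂ) * Complex.I) -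
      ∑ n ∈ Finset.Icc 1 ⌊w ^ 6⌋₊,
        1 / (n : ℂ) ^ ((σ : ℂ) + ((2 * Real.pi * w ^ 12 : ℝ) : ℂ) * Complex.I)‖ ≤ 39.2 / w := by
    intro σ h1 h2
    rcases le_total w (7 / 2) with h | h
    · exact norm_zeta_sub_sum_le_of_small h1 h2 hw0 h (by rw [hw12]; exact hτ)
    · exact norm_zeta_sub_sum_le_of_large h1 h2 h
  -- The bound 39.2/w does not involve σ, and t > 0 keeps s away from the pole, so it passes to the
  -- limit σ → 1 from the right.
  rcases hσ₁.lt_or_eq with h | h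
  · exact hmain σ h hσ₂
  · rw [← h]
    set T := 2 * Real.pi * w ^ 12 with hT
    have hT0 : 0 < T := by positivity
    have hc : ContinuousAt (fun σ : ℝ => ‖riemannZeta ((σ : ℂ) + (T : ℂ) * Complex.I) -
        ∑ n ∈ Finset.Icc 1 ⌊w ^ 6⌋₊,
          1 / (n : ℂ) ^ ((σ : ℂ) + (T : ℂ) * Complex.I)‖) 1 := by
      have hlin : ContinuousAt (fun σ : ℝ => (σ : ℂ) + (T : ℂ) * Complex.I) 1 := by fun_prop
      refine ContinuousAt.norm (ContinuousAt.sub ?_ ?_)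
      · refine ContinuousAt.comp (g := riemannZeta)
          (differentiableAt_riemannZeta ?_).continuousAt hlin
        intro h1
        have := congrArg Complex.im h1
        simp at this
        exact hT0.ne' this
      · refine tendsto_finsetSum _ fun n hn => ?_
        have hn1 : 1 ≤ n := (Finset.mem_Icc.1 hn).1
        have hn0 : (n : ℂ) ≠ 0 := by exact_mod_cast (by omega : n ≠ 0)
        refine ContinuousAt.div continuousAt_const (hlin.const_cpow (Or.inl hn0)) ?_
        simp [Complex.cpow_eq_zero_iff, hn0]
    refine le_of_tendsto (hc.tendsto.mono_left (nhdsWithin_le_nhds (s := Set.Ioi 1))) ?_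
    filter_upwards [Ioc_mem_nhdsGT (show (1 : ℝ) < 3 / 2 by norm_num)] with x hx
    exact hmain x hx.1 hx.2
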